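/- **Setting.** Let $G$ be a non-compact, locally compact, second countable, unimodular, amenable Hausdorff group with neutral element $\mathrm{id}$; write $|A|$ or $dg$ for its (two-sided invariant) Haar measure. For $K,T\subseteq G$ let $\partial_K(T)=\{g\in G: Kg\cap T\ne\emptyset,\ Kg\cap (G\setminus T)\neq\emptyset\}$; $T$ is $(K,\delta)$-invariant if $|T|>0$ and $|\partial_K(T)|/|T|<\delta$. A strong Følner sequence is a sequence $(S_n)_{n\ge1}$ of non-empty compact sets with $|\partial_K(S_n)|/|S_n|\to0$ for every non-empty compact $K$; it is nested if $\mathrm{id}\in S_1$ and $S_n\subseteq S_{n+1}$ for all $n$. For $0<\varepsilon<1$ put $N=N(\varepsilon)=\lceil\log\varepsilon/\log(1-\varepsilon)\rceil$ and $\eta_i(\varepsilon)=\varepsilon(1-\varepsilon)^{N-i}$, $1\le i\le N$. Given compact sets $T_1\subseteq\dots\subseteq T_N$, a Borel set $A$ is *$\varepsilon$-quasi tiled* (with parameter $\beta$) by the $T_i$ with finite center sets $C_1,\dots,C_N\subseteq G$ if (i) $T_iC_i\subseteq A$ for all $i$; (ii) for each $i$ the family $(T_ic)_{c\in C_i}$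 is $\varepsilon$-disjoint, i.e. there are pairwise disjoint Borel sets $D_c\subseteq T_ic$ with $|D_c|\ge(1-\varepsilon)|T_ic|$; (iii) the sets $T_1C_1,\dots,T_NC_N$ are pairwise disjoint; (iv) $\big||T_iC_i|/|A|-\eta_i(\varepsilon)\big|<\beta$ for all $i$. **Theorem (uniform continuous decompositions).** There is a function $\beta\mapsto\delta_0(\beta)>0$ such that for every strong Følner sequence $(U_k)$ in $G$ the following holds. Let $0<\varepsilon\le1/10$, $N=N(\varepsilon)$, $0<\beta,\zeta<2^{-N}\varepsilon$, let $(S_n)$ be a nested strong Følner sequence and $L\subseteq G$ compact with $\mathrm{id}\in L$. Then there are $(L,\zeta^2)$-invariant sets $\{\mathrm{id}\}\subseteq T_1\subseteq\dots\subseteq T_N$ with $T_i\in\{S_n:n\ge i\}$ such that: 1. For all $0<\delta<\delta_0(\beta)$, every precompact Borel set $A$ that is $(T_NT_N^{-1},\delta)$-invariant and satisfies $|T_N|<\delta|A|$ can be $\varepsilon$-quasi tiled (with parameter $\beta$) by the $T_i$ with suitable finite center sets. 2. There are numbers $\gamma_1,\dots,\gamma_N>0$ with $\sum_i\gamma_i|T_i|\le2$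 and an index $K$, which for the given sequence $(U_k)$ depends only on $\varepsilon$, $\beta$ and $T_1,\dots,T_N$, such that for every $k\ge K$ there are a Borel set $\Lambda_k\subseteq G$ with $0<|\Lambda_k|<\infty$ and finite center sets $C_i^\lambda$ ($\lambda\in\Lambda_k$, $1\le i\le N$) such that for every $\lambda\in\Lambda_k$ the set $U_k$ is $\varepsilon$-quasi tiled (with parameter $\beta$) by the $T_i$ with center sets $C_i^\lambda$, and moreover: (I) $\big|\bigcup_{i=1}^NT_iC_i^\lambda\big|\ge(1-4\varepsilon)|U_k|$ for all $\lambda\in\Lambda_k$. (II) For all $1\le i\le N$ and all Borel sets $S\subseteq U_k$, the function $\lambda\mapsto\mathrm{card}(C_i^\lambda\cap S)$ is integrable on $\Lambda_k$ and $$\left|\frac1{|\Lambda_k|}\int_{\Lambda_k}\frac{\mathrm{card}(C_i^\lambda\cap S)}{|U_k|}\,d\lambda-\frac{\eta_i(\varepsilon)}{|T_i|}\cdot\frac{|S|}{|U_k|}\right|<\frac{4\beta}{|T_i|}+2\varepsilon\gamma_i .$$ (III) For all $\lambda\in\Lambda_k$, $1\le i\le N$ there are Borel sets $T_i^c\subseteq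 T_i$ ($c\in C_i^\lambda$) which are $(L,4\zeta)$-invariant and satisfy $|T_i^c|\ge(1-\varepsilon)|T_i|$ and $|\partial_L(T_i^c)|\le|\partial_L(T_i)|+\zeta|T_i|$, such that the sets $T_i^cc$ ($c\in C_i^\lambda$) are pairwise disjoint with union $T_iC_i^\lambda$. -/

import Mathlib

open Set Filter Topology MeasureTheory
open scoped Pointwise ENNReal BoundedContinuousFunction

noncomputable section

namespace QuasiTiling

/-- Amenability of a topological group: there is a left invariant mean on the bounded continuous
real functions. -/
def IsAmenable (G : Type*) [Group G] [TopologicalSpace G] [IsTopologicalGroup G] : Prop :=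
  ∃ m : (G →ᵇ ℝ) →ₗ[ℝ] ℝ, m 1 = 1 ∧ (∀ f : G →ᵇ ℝ, 0 ≤ f → 0 ≤ m f) ∧
    ∀ (g : G) (f : G →ᵇ ℝ),
      m (f.compContinuous ⟨fun x => g * x, continuous_const.mul continuous_id⟩) = m f

section Group

variable {G : Type*} [Group G]

/-- The `K`-boundary of `T`: all `g` such that `Kg` meets both `T` and its complement. -/
def kBoundary (K T : Set G) : Set G :=
  {g | (K * {g} ∩ T).Nonempty ∧ (K * {g} ∩ Tᶜ).Nonempty}

/-- `N(ε) = ⌈log ε / log (1 - ε)⌉`, the number of basis sets. -/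
def tileNum (ε : ℝ) : ℕ := ⌈Real.log ε / Real.log (1 - ε)⌉₊

/-- The target density `η_i(ε) = ε (1 - ε)^(N - i)` for `1 ≤ i ≤ N`. The basis sets are indexed by
`i : Fin N`, so that the `i` of the formula is `i + 1` here. -/
def eta (ε : ℝ) {N : ℕ} (i : Fin N) : ℝ := ε * (1 - ε) ^ (N - ((i : ℕ) + 1))

/-- The largest set `T_N` of an increasing finite sequence `T_1 ⊆ … ⊆ T_N`. -/
def largest {N : ℕ} (T : Fin N → Set G) : Set G := ⋃ i, T i

/-- A sequence is nested if its first member contains the neutral element and it is increasing. -/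
def IsNested (S : ℕ → Set G) : Prop := 1 ∈ S 0 ∧ ∀ n, S n ⊆ S (n + 1)

variable [MeasurableSpace G]

/-- `T` is `(K, δ)`-invariant: `|∂_K T| / |T| < δ`. In this form a null set `T` is never
`(K, δ)`-invariant. -/
def IsKInvariant (μ : Measure G) (K : Set G) (δ : ℝ) (T : Set G) : Prop :=
  μ (kBoundary K T) < ENNReal.ofReal δ * μ T

/-- Strong Følner sequences of non-empty compact sets. (The quotients are taken in `[0, ∞]`.) -/
structure IsStrongFolner [TopologicalSpace G] (μ : Measure G) (S : ℕ → Set G) : Prop where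
  nonempty : ∀ n, (S n).Nonempty
  isCompact : ∀ n, IsCompact (S n)
  tendsto : ∀ K : Set G, K.Nonempty → IsCompact K →
    Tendsto (fun n => μ (kBoundary K (S n)) / μ (S n)) atTop (𝓝 0)

/-- A finite family `A c`, `c ∈ C`, is `ε`-disjoint: there are pairwise disjoint (Borel) sets
`D c ⊆ A c` with `|D c| ≥ (1 - ε) |A c|`. -/
def EpsDisjoint (μ : Measure G) (ε : ℝ) (C : Finset G) (A : G → Set G) : Prop :=
  ∃ D : G → Set G,
    (∀ c ∈ C, MeasurableSet (D c) ∧ D c ⊆ A c ∧ (1 - ε) * μ.real (A c) ≤ μ.real (D c)) ∧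
    (C : Set G).PairwiseDisjoint D

/-- The set `A` is `ε`-quasi tiled, with parameter `β`, by the basis sets `T i` with the finite
center sets `C i`. -/
structure IsQuasiTiling (μ : Measure G) (ε β : ℝ) {N : ℕ} (T : Fin N → Set G) (A : Set G)
    (C : Fin N → Finset G) : Prop where
  subset : ∀ i, T i * (C i : Set G) ⊆ A
  epsDisjoint : ∀ i, EpsDisjoint μ ε (C i) (fun c => T i * {c})
  disjoint : Pairwise fun i j => Disjoint (T i * (C i : Set G)) (T j * (C j : Set G))
  density : ∀ i, |μ.real (T i * (C i : Set G)) / μ.real A - eta ε i| < β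

/-- The basis sets `T i` `ε`-quasi tile the group, with parameter `β` and invariance threshold `δ₀`:
every precompact Borel set `A` which is `(T_N T_N⁻¹, δ)`-invariant for some `δ < δ₀` can be
`ε`-quasi tiled. The condition `|T_N| < δ |A|` follows from the invariance of `A`
as soon as some translate `T_N g` meets both `A` and its complement. -/
def QuasiTilesGroup [TopologicalSpace G] (μ : Measure G) (ε β δ₀ : ℝ) {N : ℕ} (T : Fin N → Set G) : Prop :=
  ∀ δ : ℝ, 0 < δ → δ < δ₀ → ∀ A : Set G, MeasurableSet A → IsCompact (closure A) →
    IsKInvariant μ (largest T * (largest T)⁻¹) δ A →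
    μ (largest T) < ENNReal.ofReal δ * μ A →
    ∃ C : Fin N → Finset G, IsQuasiTiling μ ε β T A C

/-- The translates `T i * {c}`, `c ∈ C i`, can be made disjoint with control of the
`L`-boundaries: the set `D c` below is `T_i^c ⊆ T_i`. -/
def CanBeMadeDisjoint (μ : Measure G) (ε ζ : ℝ) (L : Set G) {N : ℕ} (T : Fin N → Set G)
    (C : Fin N → Finset G) : Prop :=
  ∀ i, ∃ D : G → Set G,
    (∀ c ∈ C i, MeasurableSet (D c) ∧ D c ⊆ T i ∧
      (1 - ε) * μ.real (T i) ≤ μ.real (D c) ∧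
      IsKInvariant μ L (4 * ζ) (D c) ∧
      μ (kBoundary L (D c)) ≤ μ (kBoundary L (T i)) + ENNReal.ofReal ζ * μ (T i)) ∧
    (C i : Set G).PairwiseDisjoint (fun c => D c * {c}) ∧
    T i * (C i : Set G) = ⋃ c ∈ C i, D c * {c}

/-- The finite sequence `T_1 ⊆ … ⊆ T_N` of `(L, ζ²)`-invariant sets containing the neutral
element, taken from `S` with `T_i ∈ {S_n | n ≥ i}`, `ε`-quasi tiles the group. (Both sequences are
indexed from `0` here instead of `1`.) -/
structure IsBasis [TopologicalSpace G] (μ : Measure G) (ε β ζ δ₀ : ℝ) (S : ℕ → Set G) (L : Set G) {N : ℕ}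
    (T : Fin N → Set G) : Prop where
  one_mem : ∀ i, 1 ∈ T i
  mono : ∀ i j, i ≤ j → T i ⊆ T j
  mem_seq : ∀ i : Fin N, ∃ n : ℕ, (i : ℕ) ≤ n ∧ T i = S n
  invariant : ∀ i, IsKInvariant μ L (ζ ^ 2) (T i)
  quasiTiles : QuasiTilesGroup μ ε β δ₀ T

/-- `Λ`, with the center sets `C l i`, `l ∈ Λ`, is a uniform family of `ε`-quasi tilings of `U` by
the basis sets `T i`. -/
structure IsUniformFamily (μ : Measure G) (ε β ζ : ℝ) (L : Set G) {N : ℕ} (T : Fin N → Set G)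
    (γ : Fin N → ℝ) (U : Set G) (Λ : Set G) (C : G → Fin N → Finset G) : Prop where
  measurableSet : MeasurableSet Λ
  measure_pos : 0 < μ Λ
  measure_lt_top : μ Λ < ∞
  quasiTiling : ∀ l ∈ Λ, IsQuasiTiling μ ε β T U (C l)
  covering : ∀ l ∈ Λ, 1 - 4 * ε ≤ μ.real (⋃ i, T i * (C l i : Set G)) / μ.real U
  integrable : ∀ i, ∀ B : Set G, MeasurableSet B → B ⊆ U →
    IntegrableOn (fun l => (((C l i : Set G) ∩ B).ncard : ℝ) / μ.real U) Λ μ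
  uniform : ∀ i, ∀ B : Set G, MeasurableSet B → B ⊆ U →
    |(μ.real Λ)⁻¹ * ∫ l in Λ, (((C l i : Set G) ∩ B).ncard : ℝ) / μ.real U ∂μ
        - eta ε i / μ.real (T i) * (μ.real B / μ.real U)|
      < 4 * (β / μ.real (T i)) + 2 * ε * γ i
  madeDisjoint : ∀ l ∈ Λ, CanBeMadeDisjoint μ ε ζ L T (C l)

/-- The uniform continuous decompositions condition. The threshold `δ₀` depends only on `β`. For a
given sequence `U`, the index `K` depends only on `ε`, `β` and the basis sets. -/
def UniformContinuousDecompositions [TopologicalSpace G] (μ : Measure G) : Prop :=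
  ∃ δ₀ : ℝ → ℝ, (∀ β, 0 < β → 0 < δ₀ β) ∧
  ∀ U : ℕ → Set G, IsStrongFolner μ U →
  ∀ ε : ℝ, 0 < ε → ε ≤ 1 / 10 →
  ∀ β : ℝ, 0 < β → β < ε / 2 ^ tileNum ε →
  ∃ K : (Fin (tileNum ε) → Set G) → ℕ,
  ∀ ζ : ℝ, 0 < ζ → ζ < ε / 2 ^ tileNum ε →
  ∀ S : ℕ → Set G, IsStrongFolner μ S → IsNested S →
  ∀ L : Set G, IsCompact L → 1 ∈ L →
  ∃ T : Fin (tileNum ε) → Set G, IsBasis μ ε β ζ (δ₀ β) S L T ∧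
  ∃ γ : Fin (tileNum ε) → ℝ, (∀ i, 0 < γ i) ∧ ∑ i, γ i * μ.real (T i) ≤ 2 ∧
  ∀ k, K T ≤ k →
  ∃ (Λ : Set G) (C : G → Fin (tileNum ε) → Finset G), IsUniformFamily μ ε β ζ L T γ (U k) Λ C

end Group

end QuasiTiling

end

namespace QuasiTiling

/-! ### Calculus of `K`-boundaries and right translates. -/

section Boundary

variable {G : Type*} [Group G]

/-! The tilings are of Ornstein–Weiss type. By Tonelli, `|Tc ∩ X|` integrates over `c` to `|T||X|`.
Hence, as long as the part `X` of `A` covered by translates of `T` is smaller than about `ε|A|`,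
some `Tc ⊆ A` meets `X` in at most the proportion `ε` and simultaneously meets `∂_L X` in at most
the proportion `ζ`. Adding `Tc` with the piece `Tc \ X` keeps the family `ε`-disjoint, and the piece
has `L`-boundary at most `|∂_L T| + ζ|T|`; this yields (III) (`CanSplit.insert`, `exists_centers`).
In a tower each set is almost invariant under its predecessors. Working down from the largest set,
the uncovered rest of `A` still has a small boundary with respect to the next set, so each scale
fills about the proportion `ε` of the rest and the densities `η_i` appear as a geometric progression
(`IsTower.stronglyQuasiTiles`).

Uniformity comes from averaging over translates of one fixed tiling. Take a set `W = U_m` much more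
invariant than `U_k` and cut almost all of it into disjoint pieces `P a`, obtained from a second
tower `V` fine enough that every piece can itself be quasi tiled by the `T_i`
(`StronglyQuasiTiles.exists_pieces`). Slide the window `U_k l` over `W`, keep the centers of the
pieces inside it, and move them back by `l⁻¹`. For most `l` the retained pieces fill most of the
window (`exists_good_windows`); these `l` form `Λ_k`. A fixed center `c` is moved to `c l⁻¹`, and
`{l | c l⁻¹ ∈ S}` has measure `|S|`, because a unimodular Haar measure is inversion invariant. So
the integrated number of centers in `S` is at most their total number times `|S|`. The same bound
for `U_k \ S`, with the lower bound for the number of centers in each good window, gives the reverse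
estimate (`abs_density_sub_lt`). Overlaps of `ε`-disjoint translates cost the term `2εγ_i`, with
`γ_i = 2η_i/|T_i|`. -/

lemma kBoundary_mono {K K' : Set G} (h : K ⊆ K') (T : Set G) : kBoundary K T ⊆ kBoundary K' T :=
  fun _ hg => ⟨hg.1.mono (inter_subset_inter_left _ (mul_subset_mul_right h)),
    hg.2.mono (inter_subset_inter_left _ (mul_subset_mul_right h))⟩

lemma mem_kBoundary {K T : Set G} {g : G} :
    g ∈ kBoundary K T ↔ (∃ k ∈ K, k * g ∈ T) ∧ ∃ k ∈ K, k * g ∉ T := by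
  simp only [kBoundary, Set.Nonempty, mul_singleton, mem_inter_iff, mem_image, mem_compl_iff,
    mem_ofPred_eq]
  constructor
  · rintro ⟨⟨_, ⟨k, hk, rfl⟩, h⟩, ⟨_, ⟨k', hk', rfl⟩, h'⟩⟩
    exact ⟨⟨k, hk, h⟩, ⟨k', hk', h'⟩⟩
  · rintro ⟨⟨k, hk, h⟩, ⟨k', hk', h'⟩⟩
    exact ⟨⟨_, ⟨k, hk, rfl⟩, h⟩, ⟨_, ⟨k', hk', rfl⟩, h'⟩⟩

lemma mem_mul_singleton_iff {T : Set G} {c g : G} : g ∈ T * {c} ↔ g * c⁻¹ ∈ T := by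
  simp [mul_singleton]

lemma mul_singleton_eq_preimage (T : Set G) (c : G) : T * {c} = (fun x => x * c⁻¹) ⁻¹' T := by
  ext g; exact mem_mul_singleton_iff

lemma kBoundary_mul_singleton (K T : Set G) (c : G) :
    kBoundary K (T * {c}) = kBoundary K T * {c} := by
  ext g
  simp only [mem_mul_singleton_iff, mem_kBoundary, mul_assoc]

lemma kBoundary_empty (K : Set G) : kBoundary K ∅ = ∅ := by
  ext g; simp [mem_kBoundary]

lemma kBoundary_biUnion_subset {ι : Type*} (K : Set G) (I : Set ι) (F : ι → Set G) :
    kBoundary K (⋃ i ∈ I, F i) ⊆ ⋃ i ∈ I, kBoundary K (F i) := by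
  intro g hg
  rw [mem_kBoundary] at hg
  obtain ⟨⟨k, hk, h⟩, ⟨k', hk', h'⟩⟩ := hg
  simp only [mem_iUnion, not_exists] at h h' ⊢
  obtain ⟨i, hi, h⟩ := h
  exact ⟨i, hi, mem_kBoundary.2 ⟨⟨k, hk, h⟩, ⟨k', hk', h' i hi⟩⟩⟩

/-- Off `∂_K A` a translate `Kg` meeting `A` lies inside `A`, so it can leave `A \ Y` only through
`Y`. Intersecting with `A` in the last term matters: only the part of `∂_K Y` inside a new translate
is charged to its piece. -/
lemma kBoundary_diff_subset {K : Set G} (h1 : 1 ∈ K) (A Y : Set G) :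
    kBoundary K (A \ Y) ⊆ kBoundary K A ∪ (A ∩ kBoundary K Y) := by
  intro g hg
  by_cases hA : g ∈ kBoundary K A
  · exact Or.inl hA
  right
  rw [mem_kBoundary] at hg hA
  obtain ⟨⟨k, hk, h⟩, ⟨k', hk', h'⟩⟩ := hg
  have hall : ∀ l ∈ K, l * g ∈ A := by
    intro l hl
    by_contra hlA
    exact hA ⟨⟨k, hk, h.1⟩, ⟨l, hl, hlA⟩⟩
  refine ⟨by simpa using hall 1 h1, mem_kBoundary.2 ⟨⟨k', hk', ?_⟩, ⟨k, hk, h.2⟩⟩⟩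
  by_contra hY
  exact h' ⟨hall k' hk', hY⟩

/-- Off the `K`-boundary, a translate `K g` that meets `A` is contained in `A`. -/
lemma mul_singleton_subset_of_notMem {K A : Set G} {g k : G} (hk : k ∈ K) (hkg : k * g ∈ A)
    (hg : g ∉ kBoundary K A) : K * {g} ⊆ A := by
  intro x hx
  rw [mul_singleton] at hx
  obtain ⟨l, hl, rfl⟩ := hx
  by_contra hlA
  exact hg (mem_kBoundary.2 ⟨⟨k, hk, hkg⟩, ⟨l, hl, hlA⟩⟩)

lemma mul_coe_finset_eq_biUnion (T : Set G) (C : Finset G) :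
    T * (C : Set G) = ⋃ c ∈ C, T * {c} := by
  ext g
  simp only [Set.mem_mul, mem_iUnion, mem_singleton_iff, Finset.mem_coe]
  constructor
  · rintro ⟨t, ht, c, hc, rfl⟩; exact ⟨c, hc, t, ht, c, rfl, rfl⟩
  · rintro ⟨c, hc, t, ht, _, rfl, rfl⟩; exact ⟨t, ht, _, hc, rfl⟩

lemma kBoundary_mul_finset_subset (K T : Set G) (C : Finset G) :
    kBoundary K (T * (C : Set G)) ⊆ ⋃ c ∈ C, kBoundary K T * {c} := by
  rw [mul_coe_finset_eq_biUnion]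
  have h := kBoundary_biUnion_subset K (C : Set G) fun c => T * {c}
  simpa only [kBoundary_mul_singleton, Finset.mem_coe] using h

variable [MeasurableSpace G]

lemma IsKInvariant.mono {μ : Measure G} {K K' : Set G} {δ δ' : ℝ} {T : Set G}
    (h : IsKInvariant μ K' δ T) (hK : K ⊆ K') (hδ : δ ≤ δ') : IsKInvariant μ K δ' T :=
  (measure_mono (kBoundary_mono hK T)).trans_lt
    (h.trans_le (mul_le_mul_left (ENNReal.ofReal_le_ofReal hδ) _))

lemma IsKInvariant.measure_pos {μ : Measure G} {K : Set G} {δ : ℝ} {T : Set G}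
    (h : IsKInvariant μ K δ T) : 0 < μ T := by
  rw [pos_iff_ne_zero]
  intro h0
  simp [IsKInvariant, h0] at h

variable [TopologicalSpace G] [IsTopologicalGroup G]

lemma measure_mul_finset_lt_top {μ : Measure G} [IsFiniteMeasureOnCompacts μ] {T : Set G}
    (hT : IsCompact T) (C : Finset G) : μ (T * (C : Set G)) < ∞ :=
  (hT.mul C.finite_toSet.isCompact).measure_lt_top

variable [BorelSpace G]

lemma measure_mul_singleton (μ : Measure G) [μ.IsMulRightInvariant] (T : Set G) (c : G) :
    μ (T * {c}) = μ T := by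
  rw [mul_singleton_eq_preimage, measure_preimage_mul_right]

lemma measureReal_mul_singleton (μ : Measure G) [μ.IsMulRightInvariant] (T : Set G) (c : G) :
    μ.real (T * {c}) = μ.real T := by
  rw [Measure.real, measure_mul_singleton, Measure.real]

lemma measurableSet_mul_singleton {T : Set G} (hT : MeasurableSet T) (c : G) :
    MeasurableSet (T * {c}) := by
  rw [mul_singleton_eq_preimage]
  exact (measurable_mul_const _) hT

lemma measurableSet_mul_finset {T : Set G} (hT : MeasurableSet T) (C : Finset G) :
    MeasurableSet (T * (C : Set G)) := by
  rw [mul_coe_finset_eq_biUnion]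
  exact C.measurableSet_biUnion fun c _ => measurableSet_mul_singleton hT c

lemma IsKInvariant.mul_singleton {μ : Measure G} [μ.IsMulRightInvariant] {K : Set G} {δ : ℝ}
    {T : Set G} (h : IsKInvariant μ K δ T) (c : G) : IsKInvariant μ K δ (T * {c}) := by
  unfold IsKInvariant at *
  rwa [kBoundary_mul_singleton, measure_mul_singleton, measure_mul_singleton]

lemma measure_kBoundary_mul_finset_le (μ : Measure G) [μ.IsMulRightInvariant] (K T : Set G)
    (C : Finset G) : μ (kBoundary K (T * (C : Set G))) ≤ C.card * μ (kBoundary K T) := by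
  refine (measure_mono (kBoundary_mul_finset_subset K T C)).trans
    ((measure_biUnion_finset_le _ _).trans ?_)
  simp

end Boundary

/-! ### Averaging over translates. -/

section Averaging

variable {G : Type*} [Group G] [TopologicalSpace G] [IsTopologicalGroup G]
  [LocallyCompactSpace G] [SecondCountableTopology G] [MeasurableSpace G] [BorelSpace G]
  (μ : Measure G) [μ.IsHaarMeasure] [μ.IsMulRightInvariant]

/-- A unimodular Haar measure is invariant under inversion. -/
lemma isInvInvariant_of_unimodular [T2Space G] : μ.IsInvInvariant := by
  constructor
  obtain ⟨K, hK, hK1⟩ := exists_compact_mem_nhds (1 : G)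
  -- The inverted measure is a multiple of `μ`; a symmetric set of positive finite measure shows
  -- that the factor is 1.
  set Q : Set G := K ∪ K⁻¹
  have hQ : IsCompact Q := hK.union hK.inv
  have hQi : Q⁻¹ = Q := by simp [Q, union_comm]
  have h := Measure.isMulLeftInvariant_eq_smul μ.inv μ
  have hQpos : 0 < μ Q :=
    Measure.measure_pos_of_mem_nhds μ (mem_of_superset hK1 subset_union_left)
  have h2 : μ.inv Q = Measure.haarScalarFactor μ.inv μ • μ Q := by
    conv_lhs => rw [h]
    rfl
  rw [Measure.inv_apply, hQi] at h2
  have h3 : (Measure.haarScalarFactor μ.inv μ : ℝ≥0∞) = 1 := by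
    have h4 : (Measure.haarScalarFactor μ.inv μ : ℝ≥0∞) * μ Q = 1 * μ Q := by
      rw [one_mul]; exact h2.symm
    exact (ENNReal.mul_left_inj hQpos.ne' hQ.measure_lt_top.ne).1 h4
  have h5 : Measure.haarScalarFactor μ.inv μ = 1 := by exact_mod_cast h3
  rw [h, h5, one_smul]

/-- Right invariance writes `|Tc ∩ X|` as the integral of `1_T(t) 1_X(tc)` over `t`. Integrating
over `c` first, left invariance gives `|X|` for each `t ∈ T`. -/
lemma lintegral_measure_mul_singleton_inter {T X : Set G} (hT : MeasurableSet T)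
    (hX : MeasurableSet X) : ∫⁻ c, μ (T * {c} ∩ X) ∂μ = μ T * μ X := by
  have h1 : ∀ c, μ (T * {c} ∩ X) = ∫⁻ t, T.indicator 1 t * X.indicator 1 (t * c) ∂μ := by
    intro c
    have hset : T * {c} ∩ X = (fun x => x * c⁻¹) ⁻¹' (T ∩ (fun x => x * c) ⁻¹' X) := by
      ext g; simp
    rw [hset, measure_preimage_mul_right,
      ← lintegral_indicator_one (hT.inter ((measurable_mul_const c) hX))]
    congr 1; ext t
    simp only [inter_indicator_one]
    rfl
  simp_rw [h1]
  rw [lintegral_lintegral_swap]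
  · have h2 : ∀ t, ∫⁻ c, T.indicator 1 t * X.indicator 1 (t * c) ∂μ
        = T.indicator (fun _ => μ X) t := by
      intro t
      have hmX : Measurable fun c => X.indicator (1 : G → ℝ≥0∞) (t * c) :=
        (measurable_one.indicator hX).comp (measurable_const_mul t)
      rw [lintegral_const_mul _ hmX,
        lintegral_mul_left_eq_self (μ := μ) (fun x => X.indicator (1 : G → ℝ≥0∞) x) t,
        lintegral_indicator_one hX]
      by_cases ht : t ∈ T <;> simp [ht]
    simp_rw [h2]
    rw [lintegral_indicator hT, setLIntegral_const, mul_comm]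
  · refine Measurable.aemeasurable ?_
    exact ((measurable_one.indicator hT).comp measurable_snd).mul
      ((measurable_one.indicator hX).comp (measurable_snd.mul measurable_fst))

/-- If `|X| / ε + |H| / θ < |B|`, then some translate `T c`, `c ∈ B`, has at most the proportion
`ε` in `X` and the proportion `θ` in `H`. -/
lemma exists_translate_inter_le {T X H B : Set G} (hT : MeasurableSet T) (hX : MeasurableSet X)
    (hH : MeasurableSet H) (hT0 : 0 < μ T) (hT1 : μ T ≠ ∞)
    {ε θ : ℝ≥0∞} (hε : ε ≠ ∞) (hθ : θ ≠ ∞) (hε0 : ε ≠ 0) (hθ0 : θ ≠ 0)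
    (h : μ X / ε + μ H / θ < μ B) :
    ∃ c ∈ B, μ (T * {c} ∩ X) ≤ ε * μ T ∧ μ (T * {c} ∩ H) ≤ θ * μ T := by
  by_contra! hcon
  refine absurd h (not_lt.2 ?_)
  have hm : ∀ Y : Set G, MeasurableSet Y → Measurable fun c => μ (T * {c} ∩ Y) := by
    intro Y hY
    have hset : ∀ c, μ (T * {c} ∩ Y) = μ (Prod.mk c ⁻¹' {p : G × G | p.2 * p.1⁻¹ ∈ T ∧ p.2 ∈ Y}) := by
      intro c; congr 1; ext g; simp
    simp_rw [hset]
    refine measurable_measure_prodMk_left ?_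
    exact ((measurable_snd.mul measurable_fst.inv) hT).inter (measurable_snd hY)
  -- If every `c ∈ B` violates one of the two bounds, this normalised sum is at least 1 on `B`;
  -- integrating it contradicts the hypothesis on `|B|`.
  have key : ∀ c ∈ B, 1 ≤ (ε * μ T)⁻¹ * μ (T * {c} ∩ X) + (θ * μ T)⁻¹ * μ (T * {c} ∩ H) := by
    intro c hc
    by_cases h1 : μ (T * {c} ∩ X) ≤ ε * μ T
    · refine le_add_left ?_
      rw [← ENNReal.inv_mul_cancel (mul_ne_zero hθ0 hT0.ne') (ENNReal.mul_ne_top hθ hT1)]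
      gcongr
      exact (hcon c hc h1).le
    · refine le_add_right ?_
      rw [← ENNReal.inv_mul_cancel (mul_ne_zero hε0 hT0.ne') (ENNReal.mul_ne_top hε hT1)]
      gcongr
      exact (not_le.1 h1).le
  have hfin : ∀ (e : ℝ≥0∞) (Y : Set G), e ≠ 0 → e ≠ ∞ → (e * μ T)⁻¹ * (μ T * μ Y) = μ Y / e := by
    intro e Y he0 he
    rw [ENNReal.mul_inv (Or.inl he0) (Or.inl he), mul_assoc, ← mul_assoc (μ T)⁻¹,
      ENNReal.inv_mul_cancel hT0.ne' hT1, one_mul, mul_comm, div_eq_mul_inv]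
  calc μ B = ∫⁻ _ in B, 1 ∂μ := by simp
    _ ≤ ∫⁻ c in B, ((ε * μ T)⁻¹ * μ (T * {c} ∩ X) + (θ * μ T)⁻¹ * μ (T * {c} ∩ H)) ∂μ :=
        setLIntegral_mono (((hm X hX).const_mul _).add ((hm H hH).const_mul _)) key
    _ ≤ ∫⁻ c, ((ε * μ T)⁻¹ * μ (T * {c} ∩ X) + (θ * μ T)⁻¹ * μ (T * {c} ∩ H)) ∂μ :=
        setLIntegral_le_lintegral _ _
    _ = μ X / ε + μ H / θ := by
        rw [lintegral_add_left ((hm X hX).const_mul _), lintegral_const_mul _ (hm X hX),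
          lintegral_const_mul _ (hm H hH), lintegral_measure_mul_singleton_inter μ hT hX,
          lintegral_measure_mul_singleton_inter μ hT hH, hfin ε X hε0 hε, hfin θ H hθ0 hθ]

end Averaging

/-! ### Consequences of the strong Følner condition. -/

section Folner

variable {G : Type*} [Group G] [TopologicalSpace G] [IsTopologicalGroup G]
  [MeasurableSpace G] [BorelSpace G]
  {μ : Measure G} [μ.IsHaarMeasure] [μ.IsMulRightInvariant]

/-- A non-empty compact set whose `K`-boundary is smaller than itself is at least as large
as `K`. -/
lemma measure_le_of_measure_kBoundary_div_lt {K S : Set G} (hK1 : K ∈ 𝓝 (1 : G))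
    (hS : S.Nonempty) (hSc : IsCompact S) (h : μ (kBoundary K S) / μ S < 1) :
    μ K ≤ μ S := by
  suffices h' : ∃ g, K * {g} ⊆ S by
    obtain ⟨g, hg⟩ := h'
    rw [← measure_mul_singleton μ K g]
    exact measure_mono hg
  obtain ⟨s, hs⟩ := hS
  have hKi : K⁻¹ ∈ 𝓝 (1 : G) := by simpa using inv_mem_nhds_one G hK1
  have hpos : 0 < μ (K⁻¹ * {s}) := by
    rw [measure_mul_singleton]
    exact Measure.measure_pos_of_mem_nhds μ hKi
  -- A null set `S` is not excluded by the quotient, since `0 / 0 = 0`. Its boundary is then null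
  -- and cannot contain all `g` with `s ∈ Kg`, a set of positive measure.
  by_cases hS0 : μ S = 0
  · have hb : μ (kBoundary K S) = 0 := by
      by_contra hne
      rw [hS0, ENNReal.div_zero hne] at h
      exact absurd h (by simp)
    have : ∃ g ∈ K⁻¹ * {s}, g ∉ kBoundary K S := by
      by_contra! hsub
      exact hpos.ne' (measure_mono_null hsub hb)
    obtain ⟨g, hg, hgb⟩ := this
    obtain ⟨k, hk, _, rfl, rfl⟩ := hg
    refine ⟨_, mul_singleton_subset_of_notMem (k := k⁻¹) (mem_inv.1 hk) ?_ hgb⟩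
    simpa using hs
  · have hlt : μ (kBoundary K S) < μ S := by
      simpa using (ENNReal.div_lt_iff (Or.inl hS0) (Or.inl hSc.measure_lt_top.ne)).1 h
    have : ∃ g ∈ S, g ∉ kBoundary K S := by
      by_contra! hsub
      exact hlt.not_ge (measure_mono hsub)
    obtain ⟨g, hg, hgb⟩ := this
    exact ⟨g, mul_singleton_subset_of_notMem (mem_of_mem_nhds hK1) (by simpa using hg) hgb⟩

variable [LocallyCompactSpace G]

/-- Enlarging `K` by a compact neighbourhood of the identity forces `S n` to have positive measure
eventually, and only then does a small quotient in `[0, ∞]` give the strict inequality of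
invariance. -/
lemma IsStrongFolner.eventually_isKInvariant {S : ℕ → Set G} (hS : IsStrongFolner μ S) {K : Set G}
    (hK : IsCompact K) {δ : ℝ} (hδ : 0 < δ) : ∀ᶠ n in atTop, IsKInvariant μ K δ (S n) := by
  obtain ⟨Q, hQ, hQ1⟩ := exists_compact_mem_nhds (1 : G)
  have hne : (Q ∪ K).Nonempty := ⟨1, Or.inl (mem_of_mem_nhds hQ1)⟩
  have hQK : Q ∪ K ∈ 𝓝 (1 : G) := mem_of_superset hQ1 subset_union_left
  have ht := hS.tendsto _ hne (hQ.union hK)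
  filter_upwards [ht.eventually_lt_const (u := 1) (by simp),
    ht.eventually_lt_const (u := ENNReal.ofReal δ) (by simpa using hδ)] with n h1 h2
  have hpos : 0 < μ (S n) := (Measure.measure_pos_of_mem_nhds μ hQK).trans_le
    (measure_le_of_measure_kBoundary_div_lt hQK (hS.nonempty n) (hS.isCompact n) h1)
  refine IsKInvariant.mono (K' := Q ∪ K) ?_ subset_union_right le_rfl
  exact (ENNReal.div_lt_iff (Or.inl hpos.ne') (Or.inl (hS.isCompact n).measure_lt_top.ne)).1 h2

/-- A non-compact group has infinite Haar measure, hence compact subsets of measure above `R`;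
eventually `S n` is at least as large as such a subset. -/
lemma IsStrongFolner.eventually_le_measure [SecondCountableTopology G] [NoncompactSpace G] {S : ℕ → Set G}
    (hS : IsStrongFolner μ S) (R : ℝ) :
    ∀ᶠ n in atTop, R < μ.real (S n) := by
  obtain ⟨Q, hQ, hQ1⟩ := exists_compact_mem_nhds (1 : G)
  obtain ⟨K, hK, hKR⟩ : ∃ K : Set G, IsCompact K ∧ ENNReal.ofReal (max R 0) < μ K := by
    have h := tendsto_measure_iUnion_atTop (μ := μ) (compactCovering_subset G)
    rw [iUnion_compactCovering, measure_univ_of_isMulLeftInvariant μ] at h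
    obtain ⟨n, hn⟩ := (h.eventually_const_lt (u := ENNReal.ofReal (max R 0)) (by simp)).exists
    exact ⟨_, isCompact_compactCovering G n, hn⟩
  have hne : (Q ∪ K).Nonempty := ⟨1, Or.inl (mem_of_mem_nhds hQ1)⟩
  have hQK : Q ∪ K ∈ 𝓝 (1 : G) := mem_of_superset hQ1 subset_union_left
  filter_upwards [(hS.tendsto _ hne (hQ.union hK)).eventually_lt_const (u := 1) (by simp)]
    with n h1
  have h2 := measure_le_of_measure_kBoundary_div_lt hQK (hS.nonempty n)
    (hS.isCompact n) h1
  have h3 := hKR.trans_le ((measure_mono subset_union_right).trans h2)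
  rw [← ENNReal.ofReal_toReal (hS.isCompact n).measure_lt_top.ne] at h3
  exact (le_max_left R 0).trans_lt
    ((ENNReal.ofReal_lt_ofReal_iff_of_nonneg (le_max_right R 0)).1 h3)

end Folner

/-! ### Greedy packing by translates of a single set. -/

section SingleScale

variable {G : Type*} [Group G] [MeasurableSpace G]

/-- The translates `T * {c}`, `c ∈ C`, of one basis set can be made disjoint with control of the
`L`-boundaries. -/
def CanSplit (μ : Measure G) (ε ζ : ℝ) (L T : Set G) (C : Finset G) : Prop :=
  ∃ D : G → Set G,
    (∀ c ∈ C, MeasurableSet (D c) ∧ D c ⊆ T ∧ (1 - ε) * μ.real T ≤ μ.real (D c) ∧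
      IsKInvariant μ L (4 * ζ) (D c) ∧
      μ (kBoundary L (D c)) ≤ μ (kBoundary L T) + ENNReal.ofReal ζ * μ T) ∧
    (C : Set G).PairwiseDisjoint (fun c => D c * {c}) ∧
    T * (C : Set G) = ⋃ c ∈ C, D c * {c}

lemma canSplit_empty (μ : Measure G) (ε ζ : ℝ) (L T : Set G) : CanSplit μ ε ζ L T ∅ :=
  ⟨fun _ => ∅, by simp, by simp, by simp⟩

variable [TopologicalSpace G] [IsTopologicalGroup G] [BorelSpace G]
  {μ : Measure G} [μ.IsMulRightInvariant]
  {ε ζ : ℝ} {L T : Set G} {C : Finset G}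

lemma CanSplit.epsDisjoint (h : CanSplit μ ε ζ L T C) : EpsDisjoint μ ε C (fun c => T * {c}) := by
  obtain ⟨D, hD, hdisj, -⟩ := h
  refine ⟨fun c => D c * {c}, fun c hc => ⟨measurableSet_mul_singleton (hD c hc).1 c,
    mul_subset_mul_right (hD c hc).2.1, ?_⟩, hdisj⟩
  simpa only [measureReal_mul_singleton] using (hD c hc).2.2.1

variable [μ.IsHaarMeasure]

lemma CanSplit.card_mul_le (h : CanSplit μ ε ζ L T C) (hT : IsCompact T) :
    C.card * ((1 - ε) * μ.real T) ≤ μ.real (T * (C : Set G)) := by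
  obtain ⟨D, hD, hdisj, hU⟩ := h
  rw [hU, measureReal_biUnion_finset hdisj (fun c hc => measurableSet_mul_singleton (hD c hc).1 c)
    (fun c hc => by
      rw [measure_mul_singleton]
      exact ((measure_mono (hD c hc).2.1).trans_lt hT.measure_lt_top).ne),
    ← nsmul_eq_mul]
  refine Finset.card_nsmul_le_sum _ _ _ fun c hc => ?_
  rw [measureReal_mul_singleton]
  exact (hD c hc).2.2.1

lemma measureReal_mul_finset_le (μ : Measure G) [μ.IsMulRightInvariant] (T : Set G) (C : Finset G) :
    μ.real (T * (C : Set G)) ≤ C.card * μ.real T := by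
  rw [mul_coe_finset_eq_biUnion]
  refine (measureReal_biUnion_finset_le _ _).trans ?_
  simp only [measureReal_mul_singleton, Finset.sum_const, nsmul_eq_mul, le_refl]

/-- The new translate receives only what it adds to `X = TC`, and the old pieces stay unchanged. The
bound `hc` keeps the new piece large, and `hcL` bounds the boundary it inherits from `X`. -/
lemma CanSplit.insert [DecidableEq G] [T2Space G] (h : CanSplit μ ε ζ L T C) (hT : IsCompact T)
    (hT0 : 0 < μ T)
    (h1 : 1 ∈ L) (hε0 : 0 < ε) (hε : ε ≤ 1 / 10) (hζ0 : 0 < ζ) (hζ : ζ ≤ 1)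
    (hL : μ (kBoundary L T) ≤ ENNReal.ofReal (ζ ^ 2) * μ T) {c : G}
    (hc : μ (T * {c} ∩ (T * (C : Set G))) ≤ ENNReal.ofReal ε * μ T)
    (hcL : μ (T * {c} ∩ kBoundary L (T * (C : Set G))) ≤ ENNReal.ofReal ζ * μ T) :
    CanSplit μ ε ζ L T (insert c C) ∧
      μ.real (T * (C : Set G)) + (1 - ε) * μ.real T ≤ μ.real (T * ((insert c C : Finset G) : Set G)) ∧
      μ.real (T * ((insert c C : Finset G) : Set G)) ≤ μ.real (T * (C : Set G)) + μ.real T := by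
  have hTm := hT.measurableSet
  have hTtop := hT.measure_lt_top (μ := μ)
  set X := T * (C : Set G) with hX
  have hXm : MeasurableSet X := measurableSet_mul_finset hTm C
  have hXtop : μ X < ∞ := measure_mul_finset_lt_top hT C
  have hT0' : 0 < μ.real T := ENNReal.toReal_pos hT0.ne' hTtop.ne
  have hcr : μ.real (T * {c} ∩ X) ≤ ε * μ.real T := by
    have := ENNReal.toReal_mono (ENNReal.mul_ne_top ENNReal.ofReal_ne_top hTtop.ne) hc
    rwa [ENNReal.toReal_mul, ENNReal.toReal_ofReal hε0.le] at this
  have hcC : c ∉ C := by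
    intro hcC
    have : T * {c} ∩ X = T * {c} := inter_eq_left.2 (mul_subset_mul_left (by simpa using hcC))
    rw [this, measureReal_mul_singleton] at hcr
    nlinarith
  obtain ⟨D, hD, hdisj, hU⟩ := h
  set E : Set G := T \ (X * {c⁻¹}) with hE
  have hEm : MeasurableSet E := hTm.diff (measurableSet_mul_singleton hXm _)
  have hEc : E * {c} = (T * {c}) \ X := by
    ext g; simp [hE]
  have hEr : (1 - ε) * μ.real T ≤ μ.real E := by
    rw [← measureReal_mul_singleton μ E c, hEc]
    have h2 := measureReal_sdiff_add_inter (μ := μ) (s := T * {c}) hXm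
      (by rw [measure_mul_singleton]; exact hTtop.ne)
    rw [measureReal_mul_singleton] at h2
    linarith
  have hEb : μ (kBoundary L E) ≤ μ (kBoundary L T) + ENNReal.ofReal ζ * μ T := by
    rw [← measure_mul_singleton μ (kBoundary L E) c, ← kBoundary_mul_singleton, hEc]
    refine (measure_mono (kBoundary_diff_subset h1 _ _)).trans ((measure_union_le _ _).trans ?_)
    rw [kBoundary_mul_singleton, measure_mul_singleton]
    exact add_le_add_right hcL _
  have hEi : IsKInvariant μ L (4 * ζ) E := by
    have hEtop : μ E ≠ ∞ := ((measure_mono sdiff_subset).trans_lt hTtop).ne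
    -- Here `ζ² + ζ ≤ 2ζ`, while `4ζ|E| ≥ 4ζ(1 - ε)|T| ≥ 3.6 ζ|T|`.
    calc μ (kBoundary L E) ≤ ENNReal.ofReal (ζ ^ 2) * μ T + ENNReal.ofReal ζ * μ T :=
          hEb.trans (add_le_add_left hL _)
      _ = ENNReal.ofReal ((ζ ^ 2 + ζ) * μ.real T) := by
          rw [← add_mul, ← ENNReal.ofReal_add (by positivity) hζ0.le,
            ENNReal.ofReal_mul (by positivity), ofReal_measureReal hTtop.ne]
      _ < ENNReal.ofReal (4 * ζ * μ.real E) := by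
          refine (ENNReal.ofReal_lt_ofReal_iff_of_nonneg (by positivity)).2 ?_
          have h3 : 4 * ζ * ((1 - ε) * μ.real T) ≤ 4 * ζ * μ.real E := by gcongr
          have h4 : (ζ ^ 2 + ζ) * μ.real T ≤ (2 * ζ) * μ.real T := by gcongr; nlinarith
          have h5 : 0 < ζ * μ.real T := by positivity
          nlinarith
      _ = ENNReal.ofReal (4 * ζ) * μ E := by
          rw [ENNReal.ofReal_mul (by positivity), ofReal_measureReal hEtop]
  have hins : T * ((Insert.insert c C : Finset G) : Set G) = X ∪ E * {c} := by
    rw [hEc, union_sdiff_self, Finset.coe_insert, insert_eq, mul_union, union_comm]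
  have hne : ∀ d ∈ C, d ≠ c := fun d hd h => hcC (h ▸ hd)
  have hdX : Disjoint X (E * {c}) := by rw [hEc]; exact disjoint_sdiff_right
  refine ⟨⟨Function.update D c E, ?_, ?_, ?_⟩, ?_, ?_⟩
  · intro d hd
    rcases Finset.mem_insert.1 hd with rfl | hd
    · simp only [Function.update_self]
      exact ⟨hEm, sdiff_subset, hEr, hEi, hEb⟩
    · rw [Function.update_of_ne (hne d hd)]
      exact hD d hd
  · rw [Finset.coe_insert]
    refine (Set.pairwiseDisjoint_insert_of_notMem (by simpa using hcC)).2 ⟨?_, ?_⟩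
    · intro d hd e he hde
      simp only [Function.onFun, Function.update_of_ne (hne d hd), Function.update_of_ne (hne e he)]
      exact hdisj hd he hde
    · intro d hd
      simp only [Function.update_self, Function.update_of_ne (hne d hd)]
      refine (hdX.mono_left ?_).symm
      rw [hX, hU]
      exact subset_biUnion_of_mem (u := fun c => D c * {c}) hd
  · rw [hins, hX, hU, Finset.set_biUnion_insert, Function.update_self, union_comm]
    congr 1
    refine iUnion₂_congr fun d hd => ?_
    rw [Function.update_of_ne (hne d hd)]
  · rw [hins, measureReal_union hdX (measurableSet_mul_singleton hEm c) hXtop.ne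
      (by rw [measure_mul_singleton]; exact ((measure_mono sdiff_subset).trans_lt hTtop).ne),
      measureReal_mul_singleton]
    linarith
  · rw [hins]
    refine (measureReal_union_le _ _).trans ?_
    rw [measureReal_mul_singleton]
    have : μ.real E ≤ μ.real T := measureReal_mono sdiff_subset hTtop.ne
    linarith

variable [LocallyCompactSpace G] [SecondCountableTopology G]

/-- The greedy selection of centers: as long as the covered part `T C` of `A` has measure less
than `a`, another translate of `T` can be added. -/
lemma exists_centers [T2Space G] {A : Set G} (hT : IsCompact T)
    (hT0 : 0 < μ T)
    (h1T : 1 ∈ T) (h1 : 1 ∈ L) (hε0 : 0 < ε) (hε : ε ≤ 1 / 10) (hζ0 : 0 < ζ) (hζ : ζ ≤ 1)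
    {ρ a b : ℝ} (hρ0 : 0 ≤ ρ) (hρζ : ρ ≤ ζ ^ 2) (hL : μ (kBoundary L T) ≤ ENNReal.ofReal ρ * μ T)
    (ha : 0 ≤ a) (hb : 0 ≤ b) (hbA : μ (kBoundary T A) ≤ ENNReal.ofReal b)
    (hab : a / ε + ρ * a / ((1 - ε) * ζ) + b ≤ μ.real A) :
    ∃ C : Finset G, T * (C : Set G) ⊆ A ∧ CanSplit μ ε ζ L T C ∧
      a ≤ μ.real (T * (C : Set G)) ∧ μ.real (T * (C : Set G)) ≤ a + μ.real T := by
  classical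
  have hTtop := hT.measure_lt_top (μ := μ)
  have hT0' : 0 < μ.real T := ENNReal.toReal_pos hT0.ne' hTtop.ne
  -- The last alternative measures progress: each step gains at least `(1 - ε)|T|`, so the target
  -- `a` is reached after finitely many steps.
  have key : ∀ n : ℕ, ∃ C : Finset G, T * (C : Set G) ⊆ A ∧ CanSplit μ ε ζ L T C ∧
      μ.real (T * (C : Set G)) ≤ a + μ.real T ∧
      (a ≤ μ.real (T * (C : Set G)) ∨ n * ((1 - ε) * μ.real T) ≤ μ.real (T * (C : Set G))) := by
    intro n
    induction n with
    | zero => exact ⟨∅, by simp, canSplit_empty μ ε ζ L T, by simp; positivity, by simp⟩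
    | succ n ih =>
      obtain ⟨C, hCA, hC, hle, hor⟩ := ih
      by_cases hlt : a ≤ μ.real (T * (C : Set G))
      · exact ⟨C, hCA, hC, hle, Or.inl hlt⟩
      have hor' := hor.resolve_left hlt
      push Not at hlt
      set X := T * (C : Set G) with hX
      have hXm : MeasurableSet X := measurableSet_mul_finset hT.measurableSet C
      have hXtop : μ X < ∞ := measure_mul_finset_lt_top hT C
      have hx0 : 0 ≤ μ.real X := measureReal_nonneg
      have hbd : μ (kBoundary L X) ≤ ENNReal.ofReal (ρ * μ.real X / (1 - ε)) := by
        refine (measure_kBoundary_mul_finset_le μ L T C).trans ?_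
        calc (C.card : ℝ≥0∞) * μ (kBoundary L T)
            ≤ (C.card : ℝ≥0∞) * (ENNReal.ofReal ρ * μ T) := by gcongr
          _ = ENNReal.ofReal (C.card * (ρ * μ.real T)) := by
              rw [ENNReal.ofReal_mul (by positivity), ENNReal.ofReal_mul hρ0,
                ofReal_measureReal hTtop.ne, ENNReal.ofReal_natCast]
          _ ≤ _ := by
              refine ENNReal.ofReal_le_ofReal ?_
              rw [le_div_iff₀ (by linarith)]
              have := hC.card_mul_le hT
              calc C.card * (ρ * μ.real T) * (1 - ε) = ρ * (C.card * ((1 - ε) * μ.real T)) := by ring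
                _ ≤ _ := by gcongr
      have hB : ENNReal.ofReal (μ.real A - b) ≤ μ (A \ kBoundary T A) := by
        rw [ENNReal.ofReal_sub _ hb, tsub_le_iff_right]
        calc ENNReal.ofReal (μ.real A) ≤ μ A := ENNReal.ofReal_toReal_le
          _ ≤ μ (A \ kBoundary T A ∪ kBoundary T A) := by
              rw [sdiff_union_self]; exact measure_mono subset_union_left
          _ ≤ _ := (measure_union_le _ _).trans (add_le_add_right hbA _)
      -- Centers outside `∂_T A` keep `Tc` inside `A`. The boundary of `X` is replaced by a
      -- measurable hull; the strict inequality needed comes from `|X| < a`.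
      obtain ⟨c, hcB, hc1, hc2⟩ := exists_translate_inter_le μ (T := T) (X := X)
        (H := toMeasurable μ (kBoundary L X)) (B := A \ kBoundary T A)
        hT.measurableSet hXm (measurableSet_toMeasurable _ _) hT0 hTtop.ne
        (ε := ENNReal.ofReal ε) (θ := ENNReal.ofReal ζ) ENNReal.ofReal_ne_top ENNReal.ofReal_ne_top
        (by simpa using hε0) (by simpa using hζ0) (by
          refine lt_of_lt_of_le ?_ hB
          rw [measure_toMeasurable]
          calc μ X / ENNReal.ofReal ε + μ (kBoundary L X) / ENNReal.ofReal ζ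
              ≤ ENNReal.ofReal (μ.real X) / ENNReal.ofReal ε
                + ENNReal.ofReal (ρ * μ.real X / (1 - ε)) / ENNReal.ofReal ζ := by
                rw [ofReal_measureReal hXtop.ne]; gcongr
            _ = ENNReal.ofReal (μ.real X / ε + ρ * μ.real X / (1 - ε) / ζ) := by
                rw [← ENNReal.ofReal_div_of_pos hε0, ← ENNReal.ofReal_div_of_pos hζ0,
                  ← ENNReal.ofReal_add (by positivity)]
                have : 0 < 1 - ε := by linarith
                positivity
            _ < ENNReal.ofReal (μ.real A - b) := by
                have h1ε : 0 < 1 - ε := by linarith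
                have e1 : μ.real X / ε < a / ε := by gcongr
                have e2 : ρ * μ.real X / (1 - ε) / ζ ≤ ρ * a / ((1 - ε) * ζ) := by
                  rw [div_div]; gcongr
                have e3 : 0 ≤ μ.real X / ε + ρ * μ.real X / (1 - ε) / ζ := by positivity
                exact (ENNReal.ofReal_lt_ofReal_iff_of_nonneg e3).2 (by linarith))
      obtain ⟨hs, hs1, hs2⟩ := hC.insert hT hT0 h1 hε0 hε hζ0 hζ
        (hL.trans (by gcongr)) hc1
        ((measure_mono (inter_subset_inter_right _ (subset_toMeasurable μ _))).trans hc2)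
      refine ⟨insert c C, ?_, hs, hs2.trans (by linarith), Or.inr ?_⟩
      · rw [Finset.coe_insert, insert_eq, mul_union]
        exact union_subset (mul_singleton_subset_of_notMem h1T (by simpa using hcB.1) hcB.2) hCA
      · rw [Nat.cast_add_one]; linarith
  have hpos : 0 < (1 - ε) * μ.real T := mul_pos (by linarith) hT0'
  obtain ⟨n, hn⟩ := exists_nat_gt (a / ((1 - ε) * μ.real T))
  rw [div_lt_iff₀ hpos] at hn
  obtain ⟨C, hCA, hC, hle, hor⟩ := key n
  exact ⟨C, hCA, hC, hor.elim id fun h => hn.le.trans h, hle⟩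

end SingleScale

section Largest

variable {G : Type*}

lemma subset_largest {N : ℕ} (T : Fin N → Set G) (i : Fin N) : T i ⊆ largest T :=
  subset_iUnion T i

lemma isCompact_largest [TopologicalSpace G] {N : ℕ} {T : Fin N → Set G} (h : ∀ i, IsCompact (T i)) :
    IsCompact (largest T) := isCompact_iUnion h

lemma largest_subset_mul_inv [Group G] {N : ℕ} {T : Fin N → Set G} (h : ∀ i, 1 ∈ T i) (i : Fin N) :
    largest T ⊆ largest T * (largest T)⁻¹ := fun x hx =>
  ⟨x, hx, 1, by simpa using subset_largest T i (h i), mul_one x⟩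

end Largest

/-! ### Towers and quasi tilings with several scales. -/

section Tower

variable {G : Type*} [Group G] [TopologicalSpace G] [MeasurableSpace G]

/-- An increasing sequence of compact sets, each of them `(L, ρ)`-invariant and `(T, κ)`-invariant
for all of its predecessors `T`. -/
structure IsTower (μ : Measure G) (ρ κ : ℝ) (L : Set G) {N : ℕ} (T : Fin N → Set G) : Prop where
  one_mem : ∀ i, 1 ∈ T i
  mono : ∀ i j, i ≤ j → T i ⊆ T j
  isCompact : ∀ i, IsCompact (T i)
  invariant : ∀ i, IsKInvariant μ L ρ (T i)
  invariant_lt : ∀ i j, i < j → IsKInvariant μ (T i) κ (T j)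

/-- Every precompact Borel set that is invariant enough is quasi tiled by the `T i`, in such a way
that the translates can be made disjoint. -/
def StronglyQuasiTiles (μ : Measure G) (ε β ζ δ : ℝ) (L : Set G) {N : ℕ} (T : Fin N → Set G) :
    Prop :=
  ∀ A : Set G, MeasurableSet A → IsCompact (closure A) →
    IsKInvariant μ (largest T * (largest T)⁻¹) δ A → μ (largest T) < ENNReal.ofReal δ * μ A →
    ∃ C : Fin N → Finset G, IsQuasiTiling μ ε β T A C ∧ ∀ i, CanSplit μ ε ζ L (T i) (C i)

lemma StronglyQuasiTiles.quasiTilesGroup {μ : Measure G} {ε β β' ζ δ : ℝ} {L : Set G} {N : ℕ}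
    {T : Fin N → Set G} (h : StronglyQuasiTiles μ ε β ζ δ L T) (hβ : β ≤ β') :
    QuasiTilesGroup μ ε β' δ T := by
  intro δ' _ hδ' A hA hAc hinv hlt
  have hle := ENNReal.ofReal_le_ofReal hδ'.le
  obtain ⟨C, hC, -⟩ := h A hA hAc (hinv.mono le_rfl hδ'.le) (hlt.trans_le (by gcongr))
  exact ⟨C, hC.subset, hC.epsDisjoint, hC.disjoint, fun i => (hC.density i).trans_le hβ⟩

variable [IsTopologicalGroup G] [BorelSpace G] [LocallyCompactSpace G]
  {μ : Measure G} [μ.IsHaarMeasure] [μ.IsMulRightInvariant]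

lemma exists_isTower {S : ℕ → Set G} (hS : IsStrongFolner μ S) (hn : IsNested S) {L : Set G}
    (hL : IsCompact L) {ρ κ : ℝ} (hρ : 0 < ρ) (hκ : 0 < κ) (N : ℕ) :
    ∃ T : Fin N → Set G, IsTower μ ρ κ L T ∧ ∀ i : Fin N, ∃ n : ℕ, (i : ℕ) ≤ n ∧ T i = S n := by
  have hmono : Monotone S := monotone_nat_of_le_succ hn.2
  have h : ∀ m, ∃ n, m < n ∧ IsKInvariant μ L ρ (S n) ∧ IsKInvariant μ (S m) κ (S n) := fun m =>
    ((eventually_gt_atTop m).and ((hS.eventually_isKInvariant hL hρ).and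
      (hS.eventually_isKInvariant (hS.isCompact m) hκ))).exists
  choose g hg using h
  -- With exponent `k + 1` even the first index is a value of `g`, so the first set is also `(L,
  -- ρ)`-invariant.
  set f : ℕ → ℕ := fun k => g^[k + 1] 0 with hf
  have hsucc : ∀ k, f (k + 1) = g (f k) := fun k => Function.iterate_succ_apply' g (k + 1) 0
  have hfm : StrictMono f := strictMono_nat_of_lt_succ fun k => by rw [hsucc]; exact (hg _).1
  have hfg : ∀ k, ∃ m, f k = g m := fun k => ⟨_, Function.iterate_succ_apply' g k 0⟩
  refine ⟨fun i => S (f i), ⟨fun i => hmono (Nat.zero_le _) hn.1,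
    fun i j hij => hmono (hfm.monotone hij), fun i => hS.isCompact _, fun i => ?_, ?_⟩,
    fun i => ⟨f i, hfm.id_le _, rfl⟩⟩
  · obtain ⟨m, hm⟩ := hfg i
    rw [hm]
    exact (hg m).2.1
  · rintro ⟨i, hi⟩ ⟨j, hj⟩ hij
    obtain ⟨j, rfl⟩ : ∃ j', j = j' + 1 := ⟨j - 1, by
      have : i < j := hij
      omega⟩
    have hij' : i ≤ j := Nat.lt_succ_iff.1 hij
    dsimp only
    rw [hsucc]
    exact (hg (f j)).2.2.mono (hmono (hfm.monotone hij')) le_rfl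

variable [T2Space G] [SecondCountableTopology G]

/-- The sets of a tower with good invariance properties quasi tile all sets `A` that are invariant
enough: the largest basis set is used first, and each of the following ones is placed in what
remains of `A`. -/
lemma IsTower.stronglyQuasiTiles {ε β ζ ρ : ℝ} (hε0 : 0 < ε) (hε : ε ≤ 1 / 10) (hβ : 0 < β)
    (hζ0 : 0 < ζ) (hζ : ζ ≤ 1) (hρ0 : 0 ≤ ρ) (hρζ : ρ ≤ ζ ^ 2) (hρβ : ρ ≤ ζ * β)
    {L : Set G} (h1 : 1 ∈ L) {N : ℕ} {T : Fin N → Set G} (hT : IsTower μ ρ β L T) :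
    StronglyQuasiTiles μ ε β ζ (β / 2) L T := by
  intro A hA hAc hAinv hAlarge
  have hAtop : μ A < ∞ := (measure_mono subset_closure).trans_lt hAc.measure_lt_top
  have hA0 : 0 < μ.real A := ENNReal.toReal_pos hAinv.measure_pos.ne' hAtop.ne
  have hTtop : ∀ i, μ (T i) < ∞ := fun i => (hT.isCompact i).measure_lt_top
  have hTA : ∀ i, μ.real (T i) ≤ β / 2 * μ.real A := by
    intro i
    have := (measure_mono (subset_largest T i)).trans hAlarge.le
    have h2 := ENNReal.toReal_mono (ENNReal.mul_ne_top ENNReal.ofReal_ne_top hAtop.ne) this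
    rwa [ENNReal.toReal_mul, ENNReal.toReal_ofReal (by positivity)] at h2
  have h1ε : 0 < 1 - ε := by linarith
  -- After `m` steps the `m` largest sets have been used. Aiming at density `η_i - β/2` and
  -- overshooting by at most `|T_i| ≤ (β/2)|A|` never exceeds `η_i`, so at least `(1 - ε)^m |A|`
  -- remains.
  have key : ∀ m ≤ N, ∃ C : Fin N → Finset G, (∀ i, T i * (C i : Set G) ⊆ A) ∧
      (Pairwise fun i j => Disjoint (T i * (C i : Set G)) (T j * (C j : Set G))) ∧
      (∀ i, CanSplit μ ε ζ L (T i) (C i)) ∧ (∀ i, i.val < N - m → C i = ∅) ∧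
      (∑ i, μ.real (T i * (C i : Set G)) ≤ (1 - (1 - ε) ^ m) * μ.real A) ∧
      (∀ i, N - m ≤ i.val → (eta ε i - β / 2) * μ.real A ≤ μ.real (T i * (C i : Set G)) ∧
        μ.real (T i * (C i : Set G)) ≤ eta ε i * μ.real A) := by
    intro m
    induction m with
    | zero =>
      intro _
      exact ⟨fun _ => ∅, by simp, fun i j _ => by simp, fun i => canSplit_empty _ _ _ _ _,
        by simp, by simp, fun i hi => absurd i.2 (by omega)⟩
    | succ m ih =>
      intro hm
      obtain ⟨C, hCA, hdisj, hsplit, hempty, hsum, hdens⟩ := ih (by omega)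
      set i₀ : Fin N := ⟨N - (m + 1), by omega⟩ with hi₀
      have hC0 : C i₀ = ∅ := hempty i₀ (by simp only [hi₀]; omega)
      set Y : Set G := ⋃ i, T i * (C i : Set G) with hY
      have hYm : MeasurableSet Y := MeasurableSet.iUnion fun i =>
        measurableSet_mul_finset (hT.isCompact i).measurableSet _
      have hYA : Y ⊆ A := iUnion_subset hCA
      have hYr : μ.real Y ≤ (1 - (1 - ε) ^ m) * μ.real A :=
        (measureReal_iUnion_fintype_le _).trans hsum
      have heta : eta ε i₀ = ε * (1 - ε) ^ m := by
        simp only [eta, hi₀]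
        congr 2; omega
      set p := (1 - ε) ^ m with hp
      have hp0 : 0 < p := by positivity
      have hp1 : p ≤ 1 := pow_le_one₀ h1ε.le (by linarith)
      have hAY : p * μ.real A ≤ μ.real (A \ Y) := by
        rw [measureReal_sdiff hYA hYm hAtop.ne]
        linarith
      -- The budget `2β` covers `β/2` for `A` and `10β/9` for the translates already placed, since
      -- `card (C j) * |T j| ≤ (10/9) |T j C j|`.
      have hbd : μ (kBoundary (T i₀) (A \ Y)) ≤ ENNReal.ofReal (2 * β * μ.real A) := by
        have hb1 : μ (kBoundary (T i₀) A) ≤ ENNReal.ofReal (β / 2 * μ.real A) := by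
          rw [ENNReal.ofReal_mul (by positivity), ofReal_measureReal hAtop.ne]
          exact (hAinv.mono ((subset_largest T i₀).trans (largest_subset_mul_inv hT.one_mem i₀))
            le_rfl).le
        have hb2 : ∀ j, μ (kBoundary (T i₀) (T j * (C j : Set G)))
            ≤ ENNReal.ofReal (β * (10 / 9) * μ.real (T j * (C j : Set G))) := by
          intro j
          by_cases hj : j.val < N - m
          · rw [hempty j hj]; simp [kBoundary_empty]
          have hij : i₀ < j := by
            rw [Fin.lt_def]; simp only [hi₀]; omega
          refine (measure_kBoundary_mul_finset_le μ _ _ _).trans ?_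
          calc ((C j).card : ℝ≥0∞) * μ (kBoundary (T i₀) (T j))
              ≤ (C j).card * (ENNReal.ofReal β * μ (T j)) := by
                gcongr; exact (hT.invariant_lt i₀ j hij).le
            _ = ENNReal.ofReal ((C j).card * (β * μ.real (T j))) := by
                rw [ENNReal.ofReal_mul (by positivity), ENNReal.ofReal_mul hβ.le,
                  ofReal_measureReal (hTtop j).ne, ENNReal.ofReal_natCast]
            _ ≤ _ := by
                refine ENNReal.ofReal_le_ofReal ?_
                have h3 := (hsplit j).card_mul_le (hT.isCompact j)
                have h4 : ((C j).card : ℝ) * μ.real (T j)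
                    ≤ 10 / 9 * μ.real (T j * (C j : Set G)) := by
                  have h5 : 0 ≤ ((C j).card : ℝ) * μ.real (T j) := by positivity
                  nlinarith
                calc ((C j).card : ℝ) * (β * μ.real (T j))
                    = β * (((C j).card : ℝ) * μ.real (T j)) := by ring
                  _ ≤ β * (10 / 9 * μ.real (T j * (C j : Set G))) := by gcongr
                  _ = _ := by ring
        calc μ (kBoundary (T i₀) (A \ Y))
            ≤ μ (kBoundary (T i₀) A) + μ (kBoundary (T i₀) Y) :=
              (measure_mono ((kBoundary_diff_subset (hT.one_mem i₀) A Y).trans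
                (union_subset_union_right _ inter_subset_right))).trans (measure_union_le _ _)
          _ ≤ ENNReal.ofReal (β / 2 * μ.real A)
              + ∑ j, ENNReal.ofReal (β * (10 / 9) * μ.real (T j * (C j : Set G))) := by
              refine add_le_add hb1 ?_
              have h6 := kBoundary_biUnion_subset (T i₀) univ fun i => T i * (C i : Set G)
              simp only [mem_univ, iUnion_true] at h6
              exact (measure_mono h6).trans ((measure_iUnion_fintype_le _ _).trans
                (Finset.sum_le_sum fun j _ => hb2 j))
          _ = ENNReal.ofReal (β / 2 * μ.real A
              + ∑ j, β * (10 / 9) * μ.real (T j * (C j : Set G))) := by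
              rw [ENNReal.ofReal_add (by positivity)
                (Finset.sum_nonneg fun j _ => by positivity),
                ENNReal.ofReal_sum_of_nonneg fun j _ => by positivity]
          _ ≤ _ := by
              refine ENNReal.ofReal_le_ofReal ?_
              rw [← Finset.mul_sum]
              have h7 : ∑ i, μ.real (T i * (C i : Set G)) ≤ μ.real A := by nlinarith
              nlinarith [mul_le_mul_of_nonneg_left h7 hβ.le]
      obtain ⟨D, hDA, hDs, hD1, hD2⟩ : ∃ D : Finset G, T i₀ * (D : Set G) ⊆ A \ Y ∧
          CanSplit μ ε ζ L (T i₀) D ∧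
          (eta ε i₀ - β / 2) * μ.real A ≤ μ.real (T i₀ * (D : Set G)) ∧
          μ.real (T i₀ * (D : Set G)) ≤ eta ε i₀ * μ.real A := by
        have heta0 : 0 ≤ eta ε i₀ := by rw [heta]; positivity
        by_cases ha : eta ε i₀ - β / 2 ≤ 0
        · refine ⟨∅, by simp, canSplit_empty _ _ _ _ _, ?_, ?_⟩
          · simp only [Finset.coe_empty, mul_empty, measureReal_empty]
            exact mul_nonpos_of_nonpos_of_nonneg ha hA0.le
          · simp only [Finset.coe_empty, mul_empty, measureReal_empty]
            positivity
        · push Not at ha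
          obtain ⟨D, hDA, hDs, hD1, hD2⟩ := exists_centers (μ := μ) (L := L) (A := A \ Y)
            (hT.isCompact i₀)
            (hT.invariant i₀).measure_pos (hT.one_mem i₀) h1 hε0 hε hζ0 hζ hρ0 hρζ
            (hT.invariant i₀).le (a := (eta ε i₀ - β / 2) * μ.real A) (b := 2 * β * μ.real A)
            (by positivity) (by positivity) hbd (by
              refine le_trans ?_ hAY
              -- As `η = εp` and `ε ≤ 1/10`, the reserve `β/2` becomes at least `5β` after division
              -- by `ε`; this pays for `β` in `g2` and for `b = 2β|A|`.
              have g1 : (eta ε i₀ - β / 2) * μ.real A / ε ≤ (p - 5 * β) * μ.real A := by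
                rw [div_le_iff₀ hε0, heta]
                have : 0 < β * μ.real A := by positivity
                nlinarith
              have g2 : ρ * ((eta ε i₀ - β / 2) * μ.real A) / ((1 - ε) * ζ) ≤ β * μ.real A := by
                rw [div_le_iff₀ (by positivity)]
                have e1 : eta ε i₀ - β / 2 ≤ 1 - ε := by rw [heta]; nlinarith
                calc ρ * ((eta ε i₀ - β / 2) * μ.real A)
                    ≤ (ζ * β) * ((1 - ε) * μ.real A) := by gcongr
                  _ = _ := by ring
              have : 0 < β * μ.real A := by positivity
              nlinarith)
          refine ⟨D, hDA, hDs, hD1, hD2.trans ?_⟩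
          linarith [hTA i₀]
      have hup : ∀ j, j ≠ i₀ → Function.update C i₀ D j = C j := fun j hj =>
        Function.update_of_ne hj _ _
      have hself : Function.update C i₀ D i₀ = D := Function.update_self _ _ _
      have hDY : ∀ j, Disjoint (T i₀ * (D : Set G)) (T j * (C j : Set G)) := fun j =>
        (disjoint_sdiff_left (s := Y) (t := A)).mono hDA
          (subset_iUnion (fun i => T i * (C i : Set G)) j)
      refine ⟨Function.update C i₀ D, ?_, ?_, ?_, ?_, ?_, ?_⟩
      · intro i
        by_cases hi : i = i₀
        · subst hi; rw [hself]; exact hDA.trans sdiff_subset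
        · rw [hup i hi]; exact hCA i
      · intro i j hij
        by_cases hi : i = i₀
        · have hj : j ≠ i₀ := fun h => hij (hi.trans h.symm)
          rw [hup j hj, hi, hself]; exact hDY j
        · by_cases hj : j = i₀
          · rw [hup i hi, hj, hself]; exact (hDY i).symm
          · rw [hup i hi, hup j hj]; exact hdisj hij
      · intro i
        by_cases hi : i = i₀
        · rw [hi, hself]; exact hDs
        · rw [hup i hi]; exact hsplit i
      · intro i hi
        have hne : i ≠ i₀ := fun h => by
          rw [h] at hi; simp only [hi₀] at hi; omega
        rw [hup i hne]
        exact hempty i (by omega)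
      · rw [← Finset.add_sum_erase _ _ (Finset.mem_univ i₀), hself]
        have hs : ∑ i ∈ Finset.univ.erase i₀, μ.real (T i * (Function.update C i₀ D i : Set G))
            = ∑ i, μ.real (T i * (C i : Set G)) := by
          rw [← Finset.add_sum_erase Finset.univ _ (Finset.mem_univ i₀), hC0]
          simp only [Finset.coe_empty, mul_empty, measureReal_empty, zero_add]
          refine Finset.sum_congr rfl fun i hi => ?_
          rw [hup i (Finset.ne_of_mem_erase hi)]
        rw [hs, pow_succ, ← hp]
        rw [heta] at hD2
        nlinarith
      · intro i hi
        by_cases hne : i = i₀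
        · rw [hne, hself]; exact ⟨hD1, hD2⟩
        · rw [hup i hne]
          refine hdens i ?_
          have : i.val ≠ N - (m + 1) := fun h => hne (Fin.ext h)
          omega
  obtain ⟨C, hCA, hdisj, hsplit, -, -, hdens⟩ := key N le_rfl
  refine ⟨C, ⟨hCA, fun i => (hsplit i).epsDisjoint, hdisj, fun i => ?_⟩, hsplit⟩
  obtain ⟨h2, h3⟩ := hdens i (by omega)
  rw [← le_div_iff₀ hA0] at h2
  rw [← div_le_iff₀ hA0] at h3
  rw [abs_lt]
  constructor <;> linarith

/-- From every nested strong Følner sequence one can choose a basis for strong quasi tilings. -/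
lemma exists_stronglyQuasiTiles {S : ℕ → Set G} (hS : IsStrongFolner μ S) (hn : IsNested S)
    {L : Set G} (hL : IsCompact L) (h1 : 1 ∈ L) {ε β ζ : ℝ} (hε0 : 0 < ε) (hε : ε ≤ 1 / 10)
    (hβ : 0 < β) (hζ0 : 0 < ζ) (hζ : ζ ≤ 1) (N : ℕ) :
    ∃ T : Fin N → Set G, (∀ i, 1 ∈ T i) ∧ (∀ i j, i ≤ j → T i ⊆ T j) ∧
      (∀ i : Fin N, ∃ n : ℕ, (i : ℕ) ≤ n ∧ T i = S n) ∧
      (∀ i, IsKInvariant μ L (ζ ^ 2) (T i)) ∧ StronglyQuasiTiles μ ε β ζ (β / 2) L T := by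
  have hρ : 0 < min (ζ ^ 2) (ζ * β) := lt_min (by positivity) (by positivity)
  obtain ⟨T, hT, hTS⟩ := exists_isTower hS hn hL hρ hβ N
  exact ⟨T, hT.one_mem, hT.mono, hTS, fun i => (hT.invariant i).mono le_rfl (min_le_left _ _),
    hT.stronglyQuasiTiles hε0 hε hβ hζ0 hζ hρ.le (min_le_left _ _) (min_le_right _ _) h1⟩

end Tower

/-! ### The number of scales and the target densities. -/

section Eta

lemma tileNum_pos {ε : ℝ} (hε0 : 0 < ε) (hε : ε ≤ 1 / 10) : 0 < tileNum ε :=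
  Nat.ceil_pos.2 (div_pos_of_neg_of_neg (Real.log_neg hε0 (by linarith))
    (Real.log_neg (by linarith) (by linarith)))

lemma pow_tileNum_le {ε : ℝ} (hε0 : 0 < ε) (hε : ε ≤ 1 / 10) : (1 - ε) ^ tileNum ε ≤ ε := by
  have hlog : Real.log (1 - ε) < 0 := Real.log_neg (by linarith) (by linarith)
  have h := Nat.le_ceil (Real.log ε / Real.log (1 - ε))
  rw [div_le_iff_of_neg hlog] at h
  rw [← Real.log_le_log_iff (pow_pos (by linarith) _) hε0, Real.log_pow]
  exact h

lemma sum_eta (ε : ℝ) (N : ℕ) : ∑ i : Fin N, eta ε i = 1 - (1 - ε) ^ N := by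
  simp only [eta]
  rw [Fin.sum_univ_eq_sum_range (fun i => ε * (1 - ε) ^ (N - (i + 1))) N, ← Finset.mul_sum]
  have h1 : ∑ i ∈ Finset.range N, (1 - ε) ^ (N - (i + 1)) = ∑ i ∈ Finset.range N, (1 - ε) ^ i := by
    rw [← Finset.sum_range_reflect]
    exact Finset.sum_congr rfl fun i hi => by
      have := Finset.mem_range.1 hi
      congr 1; omega
  rw [h1]
  have h2 := geom_sum_mul (1 - ε) N
  linarith

lemma eta_pos {ε : ℝ} (hε0 : 0 < ε) (hε : ε ≤ 1 / 10) {N : ℕ} (i : Fin N) : 0 < eta ε i :=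
  mul_pos hε0 (pow_pos (by linarith) _)

lemma eta_le {ε : ℝ} (hε0 : 0 < ε) (hε : ε ≤ 1 / 10) {N : ℕ} (i : Fin N) : eta ε i ≤ ε :=
  mul_le_of_le_one_right hε0.le (pow_le_one₀ (by linarith) (by linarith))

end Eta

/-! ### Sliding windows over a large set. -/

section Windows

variable {G : Type*} [Group G]

lemma subset_mul_singleton_iff {A B : Set G} {g : G} : A ⊆ B * {g} ↔ A * {g⁻¹} ⊆ B := by
  constructor
  · intro h x hx
    have := h (mem_mul_singleton_iff.1 hx)
    simpa [mem_mul_singleton_iff] using this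
  · intro h x hx
    rw [mem_mul_singleton_iff]
    refine h (mem_mul_singleton_iff.2 ?_)
    simpa using hx

variable [TopologicalSpace G] [IsTopologicalGroup G]

lemma isClosed_setOf_subset_mul_singleton {P U : Set G} (hU : IsClosed U) :
    IsClosed {l : G | P ⊆ U * {l}} := by
  have h : {l : G | P ⊆ U * {l}} = ⋂ p ∈ P, (fun l => p * l⁻¹) ⁻¹' U := by
    ext l; simp [subset_def]
  rw [h]
  exact isClosed_biInter fun p _ => hU.preimage (by fun_prop)

variable [MeasurableSpace G] [BorelSpace G] {μ : Measure G} [μ.IsHaarMeasure]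

/-- This is the source of uniformity: the measure of the windows that move `e` into `Q` does not
depend on `e`. -/
lemma measure_preimage_mul_inv [μ.IsInvInvariant] (e : G) (Q : Set G) :
    μ ((fun l => e * l⁻¹) ⁻¹' Q) = μ Q := by
  have : (fun l => e * l⁻¹) ⁻¹' Q = Inv.inv ⁻¹' ((fun x => e * x) ⁻¹' Q) := rfl
  rw [this, Measure.measure_preimage_inv, measure_preimage_mul]

/-- If `U` is `(V, τ)`-invariant, then most windows `U l` that could contain `P ⊆ V e` do so. -/
lemma measureReal_setOf_subset_ge [μ.IsInvInvariant] {P V U W : Set G} {e : G} {τ : ℝ}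
    (hU : IsCompact U) (hW : IsCompact W) (hτ : 0 ≤ τ) (h1 : 1 ∈ V) (hP : P ⊆ V * {e})
    (hPW : P ⊆ W) (hPne : P.Nonempty) (h : IsKInvariant μ V τ U) :
    {l : G | P ⊆ U * {l}} ⊆ U⁻¹ * W ∧ (1 - τ) * μ.real U ≤ μ.real {l : G | P ⊆ U * {l}} := by
  have hsub : {l : G | P ⊆ U * {l}} ⊆ U⁻¹ * W := by
    intro l hl
    obtain ⟨p, hp⟩ := hPne
    have := mem_mul_singleton_iff.1 (hl hp)
    exact ⟨(p * l⁻¹)⁻¹, by simpa using this, p, hPW hp, by simp⟩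
  refine ⟨hsub, ?_⟩
  have hfin : μ {l : G | P ⊆ U * {l}} < ∞ :=
    (measure_mono hsub).trans_lt (hU.inv.mul hW).measure_lt_top
  have hle : μ (U \ kBoundary V U) ≤ μ {l : G | P ⊆ U * {l}} := by
    rw [← measure_preimage_mul_inv (μ := μ) e]
    refine measure_mono fun l hl => ?_
    have h2 : V * {e * l⁻¹} ⊆ U :=
      mul_singleton_subset_of_notMem h1 (by simpa using hl.1) hl.2
    change P ⊆ U * {l}
    rw [subset_mul_singleton_iff]
    refine (mul_subset_mul_right hP).trans ?_
    rwa [mul_assoc, singleton_mul_singleton]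
  have h3 : ENNReal.ofReal (μ.real U) ≤
      ENNReal.ofReal (μ.real {l : G | P ⊆ U * {l}} + τ * μ.real U) := by
    rw [ENNReal.ofReal_add (by positivity) (by positivity), ENNReal.ofReal_mul hτ,
      ofReal_measureReal hfin.ne, ofReal_measureReal hU.measure_lt_top.ne]
    calc μ U ≤ μ (U \ kBoundary V U ∪ kBoundary V U) := by
          rw [sdiff_union_self]; exact measure_mono subset_union_left
      _ ≤ _ := (measure_union_le _ _).trans (add_le_add hle h.le)
  have h4 := (ENNReal.ofReal_le_ofReal_iff (by positivity)).1 h3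
  linarith

/-- For `x ∈ U⁻¹W` the translate `Ux` meets `W`; off `∂_U W` it lies in `W`, so `x` lies in `u⁻¹W`,
a set of measure `|W|`. -/
lemma measureReal_inv_mul_le {U W : Set G} {τ : ℝ} (hU : U.Nonempty) (hW : IsCompact W)
    (hτ : 0 ≤ τ) (h : IsKInvariant μ U τ W) :
    μ.real (U⁻¹ * W) ≤ (1 + τ) * μ.real W := by
  obtain ⟨u, hu⟩ := hU
  have hle : μ (U⁻¹ * W) ≤ ENNReal.ofReal ((1 + τ) * μ.real W) := by
    rw [add_mul, one_mul, ENNReal.ofReal_add (by positivity) (by positivity), ENNReal.ofReal_mul hτ,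
      ofReal_measureReal hW.measure_lt_top.ne]
    calc μ (U⁻¹ * W) ≤ μ ((fun x => u * x) ⁻¹' W ∪ kBoundary U W) := by
          refine measure_mono ?_
          rintro _ ⟨v, hv, w, hw, rfl⟩
          by_cases hb : v * w ∈ kBoundary U W
          · exact Or.inr hb
          · have := mul_singleton_subset_of_notMem (mem_inv.1 hv) (by simpa using hw) hb
            exact Or.inl (this ⟨u, hu, _, rfl, rfl⟩)
      _ ≤ μ W + μ (kBoundary U W) := by
          refine (measure_union_le _ _).trans ?_
          rw [measure_preimage_mul]
      _ ≤ _ := by gcongr; exact h.le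
  have h2 := ENNReal.toReal_mono ENNReal.ofReal_ne_top hle
  rwa [ENNReal.toReal_ofReal (by positivity)] at h2

variable [T2Space G] [μ.IsMulRightInvariant]

open Classical in
/-- If the disjoint sets `P a` fill most of the large set `W`, then for most `l` the sets `P a`
that are contained in the window `U l` fill most of this window. -/
lemma exists_good_windows {ι : Type*} [Fintype ι] {P : ι → Set G} {U W : Set G} {β τ : ℝ}
    (hPm : ∀ a, MeasurableSet (P a)) (hPd : Pairwise fun a b => Disjoint (P a) (P b))
    (hU : IsCompact U) (hU0 : 0 < μ.real U) (hW : IsCompact W)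
    (hβ0 : 0 < β) (hτ0 : 0 ≤ τ) (hτ : τ ≤ 1 / 2) (hτβ : 32 * τ ≤ β ^ 2) (hβ1 : β ≤ 1)
    (hsum : (1 - 2 * τ) * μ.real W ≤ ∑ a, μ.real (P a))
    (hPU : ∀ a, {l : G | P a ⊆ U * {l}} ⊆ U⁻¹ * W ∧
      (1 - τ) * μ.real U ≤ μ.real {l : G | P a ⊆ U * {l}})
    (hUW : μ.real (U⁻¹ * W) ≤ (1 + τ) * μ.real W) :
    ∃ Λ : Set G, MeasurableSet Λ ∧ μ Λ < ∞ ∧ (1 - β / 2) * μ.real W ≤ μ.real Λ ∧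
      ∀ l ∈ Λ, (1 - β / 4) * μ.real U ≤ ∑ a with P a ⊆ U * {l}, μ.real (P a) := by
  set R := U⁻¹ * W with hR
  have hRc : IsCompact R := hU.inv.mul hW
  have hRm : MeasurableSet R := hRc.measurableSet
  have hRtop : μ R < ∞ := hRc.measure_lt_top
  set F : ι → Set G := fun a => {l : G | P a ⊆ U * {l}} with hF
  have hFm : ∀ a, MeasurableSet (F a) := fun a =>
    (isClosed_setOf_subset_mul_singleton hU.isClosed).measurableSet
  set f : G → ℝ := fun l => ∑ a with P a ⊆ U * {l}, μ.real (P a) with hf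
  have hfind : ∀ l, f l = ∑ a, (F a).indicator (fun _ => μ.real (P a)) l := by
    intro l
    simp only [hf, Finset.sum_filter, indicator_apply, hF, mem_ofPred_eq]
  have hfm : Measurable f := by
    have : f = fun l => ∑ a, (F a).indicator (fun _ => μ.real (P a)) l := funext hfind
    rw [this]
    exact Finset.measurable_sum _ fun a _ => measurable_const.indicator (hFm a)
  have hfU : ∀ l, f l ≤ μ.real U := by
    intro l
    have hUl : μ (U * {l}) ≠ ∞ := by
      rw [measure_mul_singleton]; exact hU.measure_lt_top.ne
    have h1 : f l = μ.real (⋃ a ∈ Finset.univ.filter fun a => P a ⊆ U * {l}, P a) := by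
      rw [measureReal_biUnion_finset (fun a _ b _ hab => hPd hab) (fun a _ => hPm a)
        (fun a ha => measure_ne_top_of_subset (Finset.mem_filter.1 ha).2 hUl)]
    rw [h1, ← measureReal_mul_singleton μ U l]
    exact measureReal_mono (iUnion₂_subset fun a ha => (Finset.mem_filter.1 ha).2) hUl
  -- A reverse Markov argument: `f` never exceeds `|U|`, and its average over `R` is close to `|U|`,
  -- so `f` is nearly maximal on most of `R`.
  set Λ : Set G := R ∩ {l | (1 - β / 4) * μ.real U ≤ f l} with hΛ
  have hΛm : MeasurableSet Λ := hRm.inter (measurableSet_le measurable_const hfm)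
  have hint : ∀ a, IntegrableOn ((F a).indicator fun _ => μ.real (P a)) R μ := fun a =>
    (integrableOn_const hRtop.ne).indicator (hFm a)
  have hfi : ∫ l in R, f l ∂μ = ∑ a, μ.real (F a) * μ.real (P a) := by
    simp_rw [hfind]
    rw [integral_finsetSum _ fun a _ => hint a]
    refine Finset.sum_congr rfl fun a _ => ?_
    rw [setIntegral_indicator (hFm a), inter_eq_right.2 (hPU a).1, setIntegral_const, smul_eq_mul]
  have hlow : (1 - τ) * μ.real U * ((1 - 2 * τ) * μ.real W) ≤ ∫ l in R, f l ∂μ := by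
    rw [hfi]
    calc (1 - τ) * μ.real U * ((1 - 2 * τ) * μ.real W)
        ≤ (1 - τ) * μ.real U * ∑ a, μ.real (P a) :=
          mul_le_mul_of_nonneg_left hsum (mul_nonneg (by linarith) hU0.le)
      _ = ∑ a, (1 - τ) * μ.real U * μ.real (P a) := Finset.mul_sum _ _ _
      _ ≤ _ := Finset.sum_le_sum fun a _ => by
          gcongr; exact (hPU a).2
  have hup : ∫ l in R, f l ∂μ
      ≤ (1 - β / 4) * μ.real U * μ.real R + β / 4 * μ.real U * μ.real Λ := by
    have hi1 : IntegrableOn (fun _ : G => (1 - β / 4) * μ.real U) R μ := integrableOn_const hRtop.ne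
    have hi2 : IntegrableOn (Λ.indicator fun _ => β / 4 * μ.real U) R μ :=
      (integrableOn_const hRtop.ne).indicator hΛm
    calc ∫ l in R, f l ∂μ
        ≤ ∫ l in R, ((1 - β / 4) * μ.real U + Λ.indicator (fun _ => β / 4 * μ.real U) l) ∂μ := by
          refine setIntegral_mono_on ?_ (hi1.add hi2) hRm fun l hl => ?_
          · have : f = fun l => ∑ a, (F a).indicator (fun _ => μ.real (P a)) l := funext hfind
            rw [this]
            exact integrable_finsetSum _ fun a _ => hint a
          · by_cases hlΛ : l ∈ Λ
            · rw [indicator_of_mem hlΛ]; linarith [hfU l]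
            · rw [indicator_of_notMem hlΛ, add_zero]
              by_contra! hlt
              exact hlΛ ⟨hl, hlt.le⟩
      _ = _ := by
          rw [integral_add hi1 hi2, setIntegral_const, setIntegral_indicator hΛm,
            inter_eq_right.2 inter_subset_left, setIntegral_const, smul_eq_mul, smul_eq_mul]
          ring
  refine ⟨Λ, hΛm, (measure_mono inter_subset_left).trans_lt hRtop, ?_, fun l hl => hl.2⟩
  have hW0 : 0 ≤ μ.real W := measureReal_nonneg
  have h1 : (1 - τ) * ((1 - 2 * τ) * μ.real W)
      ≤ (1 - β / 4) * μ.real R + β / 4 * μ.real Λ := by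
    refine le_of_mul_le_mul_left ?_ hU0
    linarith
  have h2 : (1 - β / 4) * μ.real R ≤ (1 - β / 4) * ((1 + τ) * μ.real W) := by
    gcongr; linarith
  have h3 : β / 4 * ((1 - β / 2) * μ.real W) ≤ β / 4 * μ.real Λ := by
    -- The right side is at least `β/4 - 4τ`, which is where `32τ ≤ β²` enters.
    have h4 : (β / 4 * (1 - β / 2)) ≤ (1 - τ) * (1 - 2 * τ) - (1 - β / 4) * (1 + τ) := by nlinarith
    have := mul_le_mul_of_nonneg_right h4 hW0
    linarith
  exact le_of_mul_le_mul_left h3 (by positivity)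

end Windows

/-! ### Translating and combining splittings. -/

section Gluing

variable {G : Type*} [Group G]

lemma mul_image_mul_right [DecidableEq G] (T : Set G) (C : Finset G) (g : G) :
    T * ((C.image (· * g) : Finset G) : Set G) = T * (C : Set G) * {g} := by
  rw [Finset.coe_image, mul_assoc, mul_singleton]

variable [MeasurableSpace G] {μ : Measure G} {ε ζ : ℝ} {L T : Set G}

lemma CanSplit.image_mul_right [DecidableEq G] {C : Finset G} (h : CanSplit μ ε ζ L T C) (g : G) :
    CanSplit μ ε ζ L T (C.image (· * g)) := by
  obtain ⟨D, hD, hdisj, hU⟩ := h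
  refine ⟨fun c => D (c * g⁻¹), ?_, ?_, ?_⟩
  · intro c hc
    obtain ⟨c, hc', rfl⟩ := Finset.mem_image.1 hc
    simpa using hD c hc'
  · intro c hc d hd hcd
    obtain ⟨c, hc', rfl⟩ := Finset.mem_image.1 hc
    obtain ⟨d, hd', rfl⟩ := Finset.mem_image.1 hd
    have h := hdisj hc' hd' fun h => hcd (by rw [h])
    simp only [Function.onFun, mul_inv_cancel_right] at h ⊢
    rw [← singleton_mul_singleton, ← singleton_mul_singleton, ← mul_assoc, ← mul_assoc,
      mul_singleton_eq_preimage _ g, mul_singleton_eq_preimage _ g]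
    exact h.preimage _
  · rw [mul_image_mul_right, hU, Finset.set_biUnion_finset_image, iUnion₂_mul]
    refine iUnion₂_congr fun c _ => ?_
    simp only [mul_inv_cancel_right]
    rw [mul_assoc, singleton_mul_singleton]

/-- Because `1 ∈ T`, a center in `C a` lies in `P a`, so it belongs to exactly one index; its piece
is the one chosen for that index. -/
lemma CanSplit.biUnion [DecidableEq G] {ι : Type*} {I : Finset ι} {C : ι → Finset G} {P : ι → Set G}
    (h1 : 1 ∈ T) (hP : (I : Set ι).PairwiseDisjoint P) (hC : ∀ a ∈ I, T * (C a : Set G) ⊆ P a)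
    (h : ∀ a ∈ I, CanSplit μ ε ζ L T (C a)) : CanSplit μ ε ζ L T (I.biUnion C) := by
  choose! D hD hdisj hU using h
  have hmem : ∀ a ∈ I, ∀ c ∈ C a, c ∈ P a := fun a ha c hc => hC a ha ⟨1, h1, c, hc, one_mul c⟩
  have hsub : ∀ a ∈ I, ∀ c ∈ C a, D a c * {c} ⊆ P a := fun a ha c hc => by
    refine Subset.trans ?_ (hC a ha)
    exact (mul_subset_mul_right (hD a ha c hc).2.1).trans
      (mul_subset_mul_left (by simpa using hc))
  have huniq : ∀ a ∈ I, ∀ b ∈ I, ∀ c, c ∈ C a → c ∈ C b → a = b := by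
    intro a ha b hb c hca hcb
    by_contra hab
    exact (Set.disjoint_left.1 (hP ha hb hab)) (hmem a ha c hca) (hmem b hb c hcb)
  have hex : ∀ c ∈ I.biUnion C, ∃ a ∈ I, c ∈ C a := fun c hc => by simpa using hc
  rcases isEmpty_or_nonempty ι with hι | hι
  · have : I.biUnion C = ∅ := Finset.eq_empty_of_forall_notMem fun c hc => by
      obtain ⟨a, -⟩ := hex c hc
      exact hι.elim a
    rw [this]; exact canSplit_empty _ _ _ _ _
  choose! s hsI hsC using hex
  have hs : ∀ a ∈ I, ∀ c ∈ C a, s c = a := fun a ha c hc =>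
    have hc' : c ∈ I.biUnion C := Finset.mem_biUnion.2 ⟨a, ha, hc⟩
    huniq _ (hsI c hc') _ ha c (hsC c hc') hc
  refine ⟨fun c => D (s c) c, fun c hc => hD _ (hsI c hc) c (hsC c hc), ?_, ?_⟩
  · intro c hc d hd hcd
    have hc' := hsC c hc
    have hd' := hsC d hd
    by_cases hcs : s c = s d
    · simp only [Function.onFun]
      rw [hcs] at hc' ⊢
      exact hdisj _ (hsI d hd) hc' hd' hcd
    · exact (hP (hsI c hc) (hsI d hd) hcs).mono (hsub _ (hsI c hc) c hc') (hsub _ (hsI d hd) d hd')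
  · rw [Finset.coe_biUnion, mul_iUnion₂, Finset.set_biUnion_biUnion]
    refine iUnion₂_congr fun a ha => ?_
    rw [hU a ha]
    exact iUnion₂_congr fun c hc => by simp only [hs a ha c hc]

end Gluing

/-! ### Centers seen through a window, and their counting function. -/

section WindowCenters

variable {G : Type*} [Group G] {ι : Type*} [Fintype ι]

open Classical in
/-- The centers belonging to those of the sets `P a` that are contained in the window `U l`, moved
to `U`. -/
noncomputable def windowCenters (P : ι → Set G) (U : Set G) (C : ι → Finset G) (l : G) : Finset G :=
  (Finset.univ.filter fun a => P a ⊆ U * {l}).biUnion fun a => (C a).image (· * l⁻¹)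

variable {P : ι → Set G} {U T : Set G} {C : ι → Finset G}

lemma mul_windowCenters (P : ι → Set G) (U T : Set G) (C : ι → Finset G) (l : G) :
    T * (windowCenters P U C l : Set G)
      = ⋃ a ∈ {a | P a ⊆ U * {l}}, T * (C a : Set G) * {l⁻¹} := by
  classical
  rw [windowCenters, Finset.coe_biUnion, mul_iUnion₂]
  simp only [mul_image_mul_right, Finset.coe_filter, Finset.mem_univ, true_and]

lemma mul_windowCenters_subset (hC : ∀ a, T * (C a : Set G) ⊆ P a) (l : G) :
    T * (windowCenters P U C l : Set G) ⊆ U := by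
  rw [mul_windowCenters]
  exact iUnion₂_subset fun a ha =>
    subset_mul_singleton_iff.1 ((hC a).trans ha)

lemma windowCenters_subset (h1 : 1 ∈ T) (hC : ∀ a, T * (C a : Set G) ⊆ P a) (l : G) :
    (windowCenters P U C l : Set G) ⊆ U := fun c hc =>
  mul_windowCenters_subset hC l ⟨1, h1, c, hc, one_mul c⟩

lemma disjoint_mul_windowCenters {T' : Set G} {C' : ι → Finset G}
    (hPd : Pairwise fun a b => Disjoint (P a) (P b))
    (hC : ∀ a, T * (C a : Set G) ⊆ P a) (hC' : ∀ a, T' * (C' a : Set G) ⊆ P a)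
    (hd : ∀ a, Disjoint (T * (C a : Set G)) (T' * (C' a : Set G))) (l : G) :
    Disjoint (T * (windowCenters P U C l : Set G)) (T' * (windowCenters P U C' l : Set G)) := by
  rw [mul_windowCenters, mul_windowCenters]
  simp only [disjoint_iUnion_left, disjoint_iUnion_right]
  intro a _ b _
  rw [mul_singleton_eq_preimage _ l⁻¹, mul_singleton_eq_preimage _ l⁻¹]
  refine Disjoint.preimage _ ?_
  by_cases hab : a = b
  · subst hab; exact hd _
  · exact (hPd (Ne.symm hab)).mono (hC _) (hC' _)

/-- Centers from different pieces are distinct, so the count is a finite sum of indicators in `l`;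
this gives integrability and lets each center be integrated separately. -/
lemma ncard_windowCenters_inter (h1 : 1 ∈ T) (hPd : Pairwise fun a b => Disjoint (P a) (P b))
    (hC : ∀ a, T * (C a : Set G) ⊆ P a) (B : Set G) (l : G) :
    (((windowCenters P U C l : Set G) ∩ B).ncard : ℝ) = ∑ a, ∑ c ∈ C a,
      ({l | P a ⊆ U * {l}} ∩ (fun l => c * l⁻¹) ⁻¹' B).indicator (fun _ => (1 : ℝ)) l := by
  classical
  have hw : windowCenters P U C l = (Finset.univ.filter fun a => P a ⊆ U * {l}).biUnion
      fun a => (C a).image (· * l⁻¹) := by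
    unfold windowCenters; congr
  have h : (windowCenters P U C l : Set G) ∩ B
      = (((windowCenters P U C l).filter (· ∈ B) : Finset G) : Set G) := by
    ext x; simp
  have hmem : ∀ a, ∀ c ∈ C a, c ∈ P a := fun a c hc => hC a ⟨1, h1, c, hc, one_mul c⟩
  rw [h, Set.ncard_coe_finset, hw, Finset.filter_biUnion, Finset.card_biUnion, Finset.sum_filter]
  · push_cast
    refine Finset.sum_congr rfl fun a _ => ?_
    by_cases ha : P a ⊆ U * {l}
    · rw [if_pos ha, Finset.filter_image, Finset.card_image_of_injective _ (mul_left_injective l⁻¹),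
        Finset.card_filter]
      push_cast
      refine Finset.sum_congr rfl fun c _ => ?_
      have hl : l ∈ {l | P a ⊆ U * {l}} := ha
      simp only [indicator_apply, mem_inter_iff, hl, true_and, mem_preimage]
    · rw [if_neg ha]
      refine (Finset.sum_eq_zero fun c _ => ?_).symm
      exact indicator_of_notMem (fun h => ha h.1) _
  · intro a _ b _ hab
    refine Finset.disjoint_filter_filter ?_
    rw [Finset.disjoint_left]
    intro x hx hx'
    obtain ⟨c, hc, rfl⟩ := Finset.mem_image.1 hx
    obtain ⟨d, hd, hdc⟩ := Finset.mem_image.1 hx'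
    have : d = c := mul_right_cancel hdc
    subst this
    exact Set.disjoint_left.1 (hPd hab) (hmem a _ hc) (hmem b _ hd)

variable [MeasurableSpace G] {μ : Measure G} {ε ζ : ℝ} {L : Set G}

lemma canSplit_windowCenters (h1 : 1 ∈ T) (hPd : Pairwise fun a b => Disjoint (P a) (P b))
    (hC : ∀ a, T * (C a : Set G) ⊆ P a) (h : ∀ a, CanSplit μ ε ζ L T (C a)) (l : G) :
    CanSplit μ ε ζ L T (windowCenters P U C l) := by
  classical
  have : windowCenters P U C l = (Finset.univ.filter fun a => P a ⊆ U * {l}).biUnion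
      fun a => (C a).image (· * l⁻¹) := by
    unfold windowCenters; congr
  rw [this]
  refine CanSplit.biUnion (P := fun a => P a * {l⁻¹}) h1 ?_ ?_ fun a _ => (h a).image_mul_right _
  · intro a _ b _ hab
    simp only [Function.onFun]
    rw [mul_singleton_eq_preimage _ l⁻¹, mul_singleton_eq_preimage _ l⁻¹]
    exact (hPd hab).preimage _
  · intro a _
    rw [mul_image_mul_right]
    exact mul_subset_mul_right (hC a)

variable [TopologicalSpace G] [IsTopologicalGroup G] [BorelSpace G]

open Classical in
lemma measureReal_mul_windowCenters [T2Space G] [μ.IsHaarMeasure] [μ.IsMulRightInvariant]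
    (hPd : Pairwise fun a b => Disjoint (P a) (P b))
    (hT : IsCompact T) (hC : ∀ a, T * (C a : Set G) ⊆ P a) (l : G) :
    μ.real (T * (windowCenters P U C l : Set G))
      = ∑ a with P a ⊆ U * {l}, μ.real (T * (C a : Set G)) := by
  have h : T * (windowCenters P U C l : Set G)
      = ⋃ a ∈ Finset.univ.filter fun a => P a ⊆ U * {l}, T * (C a : Set G) * {l⁻¹} := by
    rw [mul_windowCenters]; simp
  rw [h, measureReal_biUnion_finset (h := fun a _ => by
    rw [measure_mul_singleton]
    exact (measure_mul_finset_lt_top hT _).ne)]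
  · exact Finset.sum_congr rfl fun a _ => measureReal_mul_singleton _ _ _
  · intro a _ b _ hab
    simp only [Function.onFun]
    rw [mul_singleton_eq_preimage _ l⁻¹, mul_singleton_eq_preimage _ l⁻¹]
    exact ((hPd hab).mono (hC a) (hC b)).preimage _
  · exact fun a _ => measurableSet_mul_singleton (measurableSet_mul_finset hT.measurableSet _) _

lemma integrableOn_ncard_windowCenters (h1 : 1 ∈ T)
    (hPd : Pairwise fun a b => Disjoint (P a) (P b)) (hU : IsClosed U)
    (hC : ∀ a, T * (C a : Set G) ⊆ P a) {B Λ : Set G} (hB : MeasurableSet B) (hΛ : μ Λ < ∞) :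
    IntegrableOn (fun l => (((windowCenters P U C l : Set G) ∩ B).ncard : ℝ)) Λ μ := by
  simp_rw [ncard_windowCenters_inter h1 hPd hC]
  refine integrable_finsetSum _ fun a _ => integrable_finsetSum _ fun c _ => ?_
  refine (integrableOn_const hΛ.ne).indicator
    ((isClosed_setOf_subset_mul_singleton hU).measurableSet.inter ?_)
  exact (continuous_const.mul continuous_inv).measurable hB

/-- Dropping the conditions `P a ⊆ U l` and `l ∈ Λ`, each center `c` contributes at most the measure
of `{l | c l⁻¹ ∈ B}`, which is `|B|`. -/
lemma integral_ncard_windowCenters_le [μ.IsHaarMeasure] [μ.IsInvInvariant] (h1 : 1 ∈ T)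
    (hPd : Pairwise fun a b => Disjoint (P a) (P b)) (hU : IsClosed U)
    (hC : ∀ a, T * (C a : Set G) ⊆ P a) {B Λ : Set G} (hB : MeasurableSet B) (hBtop : μ B < ∞)
    (hΛ : μ Λ < ∞) :
    ∫ l in Λ, (((windowCenters P U C l : Set G) ∩ B).ncard : ℝ) ∂μ
      ≤ (∑ a, (C a).card : ℕ) * μ.real B := by
  simp_rw [ncard_windowCenters_inter h1 hPd hC]
  have hm : ∀ a c, MeasurableSet ({l : G | P a ⊆ U * {l}} ∩ (fun l => c * l⁻¹) ⁻¹' B) := fun a c =>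
    (isClosed_setOf_subset_mul_singleton hU).measurableSet.inter
      ((continuous_const.mul continuous_inv).measurable hB)
  have hi : ∀ a c, IntegrableOn (({l : G | P a ⊆ U * {l}} ∩ (fun l => c * l⁻¹) ⁻¹' B).indicator
      fun _ => (1 : ℝ)) Λ μ := fun a c => (integrableOn_const hΛ.ne).indicator (hm a c)
  rw [integral_finsetSum _ fun a _ => integrable_finsetSum _ fun c _ => hi a c]
  push_cast
  rw [Finset.sum_mul]
  refine Finset.sum_le_sum fun a _ => ?_
  rw [integral_finsetSum _ fun c _ => hi a c, ← nsmul_eq_mul]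
  refine Finset.sum_le_card_nsmul _ _ _ fun c _ => ?_
  rw [setIntegral_indicator (hm a c), setIntegral_const, smul_eq_mul, mul_one]
  have hmu : μ.real ((fun l => c * l⁻¹) ⁻¹' B) = μ.real B := by
    rw [Measure.real, measure_preimage_mul_inv, Measure.real]
  rw [← hmu]
  exact measureReal_mono (inter_subset_right.trans inter_subset_right)
    (by rw [measure_preimage_mul_inv]; exact hBtop.ne)

end WindowCenters

/-! ### The uniformity estimate. -/

section UniformFamily

variable {G : Type*} [Group G] [TopologicalSpace G] [IsTopologicalGroup G] [T2Space G]
  [MeasurableSpace G] [BorelSpace G] {μ : Measure G} [μ.IsHaarMeasure]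

/-- The densities add up to at least `1 - (1 - ε)^N - Nβ`, and both errors are at most `ε`. -/
lemma IsQuasiTiling.le_covering {ε β : ℝ} (hε0 : 0 < ε) (hε : ε ≤ 1 / 10)
    (hβ : β < ε / 2 ^ tileNum ε) {T : Fin (tileNum ε) → Set G} {A : Set G}
    {C : Fin (tileNum ε) → Finset G} (hT : ∀ i, IsCompact (T i)) (h : IsQuasiTiling μ ε β T A C) :
    1 - 4 * ε ≤ μ.real (⋃ i, T i * (C i : Set G)) / μ.real A := by
  rw [measureReal_iUnion_fintype h.disjoint
    (fun i => measurableSet_mul_finset (hT i).measurableSet _)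
    (fun i => (measure_mul_finset_lt_top (hT i) _).ne), Finset.sum_div]
  have h1 : ∑ i : Fin (tileNum ε), (eta ε i - β)
      ≤ ∑ i, μ.real (T i * (C i : Set G)) / μ.real A :=
    Finset.sum_le_sum fun i _ => by linarith [(abs_lt.1 (h.density i)).1]
  rw [Finset.sum_sub_distrib, sum_eta] at h1
  simp only [Finset.sum_const, Finset.card_univ, Fintype.card_fin, nsmul_eq_mul] at h1
  have h2 := pow_tileNum_le hε0 hε
  have h3 : (tileNum ε : ℝ) * β ≤ ε := by
    have h4 : (tileNum ε : ℝ) ≤ 2 ^ tileNum ε := by exact_mod_cast (Nat.lt_two_pow_self).le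
    calc (tileNum ε : ℝ) * β ≤ tileNum ε * (ε / 2 ^ tileNum ε) := by gcongr
      _ = tileNum ε / 2 ^ tileNum ε * ε := by ring
      _ ≤ 1 * ε := by
          gcongr
          exact (div_le_one (by positivity)).2 h4
      _ = ε := one_mul ε
  linarith

/-- Numerical part of the uniformity estimate: `q` is the measure of a basis set, `n` the total
number of centers, `w` and `v` the measures of the large set and of `Λ`, `x` and `y` the integrals
of the numbers of centers in a set of measure `b` and in its complement in the window of
measure `u`. -/
lemma abs_density_sub_lt {ε β η q n v w u b x y : ℝ} (hε0 : 0 < ε) (hε : ε ≤ 1 / 10) (hβ0 : 0 < β)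
    (hβ : β ≤ 1 / 10) (hη0 : 0 < η) (hη : η ≤ ε) (hq : 0 < q) (hv : 0 < v) (hu : 0 < u)
    (hn : n * ((1 - ε) * q) ≤ (η + β / 4) * w) (hwv : (1 - β / 2) * w ≤ v) (hb : 0 ≤ b) (hbu : b ≤ u)
    (hx : x ≤ n * b) (hy : y ≤ n * (u - b)) (hxy : (η - β / 2) * u * v ≤ (x + y) * q) :
    |v⁻¹ * (x / u) - η / q * (b / u)| < 4 * (β / q) + 2 * ε * (2 * η / q) := by
  -- `k` bounds `(η + β/4) / ((1 - ε)(1 - β/2))`, hence the center density `nq/v`.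
  set k := η + 2 * ε * η + 2 * β with hk
  have hnk : n * q ≤ k * v := by
    have h1 : (η + β / 4) ≤ k * ((1 - ε) * (1 - β / 2)) := by
      have h2 : (1 - ε) * (1 - β / 2) ≥ 1 - ε - β / 2 := by nlinarith [mul_pos hε0 hβ0]
      have h3 : 0 < k := by positivity
      have h4 : k * (1 - ε - β / 2) ≤ k * ((1 - ε) * (1 - β / 2)) := by gcongr
      refine le_trans ?_ h4
      have h5 : 0 < ε * η := by positivity
      have h6 : ε * (ε * η) ≤ 1 / 10 * (ε * η) := by gcongr
      have h7 : ε * β ≤ 1 / 10 * β := by gcongr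
      have h8 : β * k ≤ β * (1 / 2) := by
        gcongr
        nlinarith
      nlinarith
    have h2 : (1 - ε) * (1 - β / 2) > 0 := mul_pos (by linarith) (by linarith)
    have h3 : n * q * ((1 - ε) * (1 - β / 2)) ≤ (η + β / 4) * v := by
      calc n * q * ((1 - ε) * (1 - β / 2)) = (1 - β / 2) * (n * ((1 - ε) * q)) := by ring
        _ ≤ (1 - β / 2) * ((η + β / 4) * w) := by gcongr; linarith
        _ = (η + β / 4) * ((1 - β / 2) * w) := by ring
        _ ≤ _ := by gcongr
    have h4 : n * q * ((1 - ε) * (1 - β / 2)) ≤ k * v * ((1 - ε) * (1 - β / 2)) := by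
      refine h3.trans ?_
      calc (η + β / 4) * v ≤ k * ((1 - ε) * (1 - β / 2)) * v := by gcongr
        _ = _ := by ring
    exact le_of_mul_le_mul_right h4 h2
  have hxq : x * q ≤ k * v * b := by
    calc x * q ≤ n * b * q := by gcongr
      _ = n * q * b := by ring
      _ ≤ _ := by gcongr
  have hyq : y * q ≤ k * v * (u - b) := by
    calc y * q ≤ n * (u - b) * q := by gcongr
      _ = n * q * (u - b) := by ring
      _ ≤ _ := by gcongr
  have heq : v⁻¹ * (x / u) - η / q * (b / u) = (x * q - η * b * v) / (v * u * q) := by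
    field_simp
  have heq2 : 4 * (β / q) + 2 * ε * (2 * η / q) = (4 * β + 4 * ε * η) * (v * u) / (v * u * q) := by
    field_simp; ring
  have hpos : 0 < v * u * q := by positivity
  have hvb : v * b ≤ v * u := by gcongr
  have hvb0 : 0 ≤ v * b := by positivity
  have hvu : 0 < v * u := by positivity
  have hεη : 0 < ε * η := by positivity
  have herr : (2 * ε * η + 2 * β) * (v * b) ≤ (2 * ε * η + 2 * β) * (v * u) := by gcongr
  rw [heq, heq2, abs_div, abs_of_pos hpos, div_lt_div_iff_of_pos_right hpos, abs_lt]
  have hbig : 0 < (2 * ε * η + β) * (v * u) := by positivity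
  -- The lower bound uses the total `x + y` and the upper bound for `y`; the upper bound uses `x`
  -- alone.
  constructor
  · have h9 : 0 ≤ (2 * ε * η + 2 * β) * (v * b) := by positivity
    have : 0 < β * (v * u) := by positivity
    nlinarith
  · nlinarith

open Classical in
/-- Disjoint quasi tiled sets `P a`, together with a set `Λ` of good windows, give a uniform family
of quasi tilings. -/
lemma isUniformFamily_windowCenters [μ.IsMulRightInvariant] [μ.IsInvInvariant] {ι : Type*} [Fintype ι] {P : ι → Set G}
    {U W Λ L : Set G}
    {ε β ζ : ℝ} (hε0 : 0 < ε) (hε : ε ≤ 1 / 10) (hβ0 : 0 < β) (hβ : β < ε / 2 ^ tileNum ε)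
    {T : Fin (tileNum ε) → Set G} (hT : ∀ i, IsCompact (T i)) (hT1 : ∀ i, 1 ∈ T i)
    (hT0 : ∀ i, 0 < μ (T i))
    (hU : IsCompact U) (hU0 : 0 < μ.real U) (hW : IsCompact W) (hW0 : 0 < μ.real W)
    (hPm : ∀ a, MeasurableSet (P a)) (hPd : Pairwise fun a b => Disjoint (P a) (P b))
    (hPW : ∀ a, P a ⊆ W) (hP0 : ∀ a, 0 < μ.real (P a))
    {C : ι → Fin (tileNum ε) → Finset G} (hC : ∀ a, IsQuasiTiling μ ε (β / 4) T (P a) (C a))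
    (hs : ∀ a i, CanSplit μ ε ζ L (T i) (C a i))
    (hΛm : MeasurableSet Λ) (hΛtop : μ Λ < ∞) (hΛW : (1 - β / 2) * μ.real W ≤ μ.real Λ)
    (hΛ : ∀ l ∈ Λ, (1 - β / 4) * μ.real U ≤ ∑ a with P a ⊆ U * {l}, μ.real (P a)) :
    IsUniformFamily μ ε β ζ L T (fun i => 2 * eta ε i / μ.real (T i)) U Λ
      fun l i => windowCenters P U (fun a => C a i) l := by
  have hβ1 : β ≤ 1 / 10 := by
    have : ε / 2 ^ tileNum ε ≤ ε := div_le_self hε0.le (one_le_pow₀ (by norm_num))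
    linarith
  have hTtop : ∀ i, μ (T i) < ∞ := fun i => (hT i).measure_lt_top
  have hTr : ∀ i, 0 < μ.real (T i) := fun i => ENNReal.toReal_pos (hT0 i).ne' (hTtop i).ne
  have hCP : ∀ i a, T i * (C a i : Set G) ⊆ P a := fun i a => (hC a).subset i
  have hΛ0 : 0 < μ.real Λ := lt_of_lt_of_le (mul_pos (by linarith) hW0) hΛW
  have hPtop : ∀ a, μ (P a) ≠ ∞ := fun a =>
    measure_ne_top_of_subset (hPW a) hW.measure_lt_top.ne
  have hdens : ∀ a i, (eta ε i - β / 4) * μ.real (P a) ≤ μ.real (T i * (C a i : Set G)) ∧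
      μ.real (T i * (C a i : Set G)) ≤ (eta ε i + β / 4) * μ.real (P a) := by
    intro a i
    have h := abs_lt.1 ((hC a).density i)
    rw [← le_div_iff₀ (hP0 a), ← div_le_iff₀ (hP0 a)]
    constructor <;> linarith
  have hsumU : ∀ l, ∑ a with P a ⊆ U * {l}, μ.real (P a) ≤ μ.real U := by
    intro l
    have hUl : μ (U * {l}) ≠ ∞ := by
      rw [measure_mul_singleton]; exact hU.measure_lt_top.ne
    rw [← measureReal_biUnion_finset (fun a _ b _ hab => hPd hab) (fun a _ => hPm a)
      (fun a _ => hPtop a), ← measureReal_mul_singleton μ U l]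
    exact measureReal_mono (iUnion₂_subset fun a ha => (Finset.mem_filter.1 ha).2) hUl
  have hdensU : ∀ l ∈ Λ, ∀ i,
      (eta ε i - β / 2) * μ.real U ≤ μ.real (T i * (windowCenters P U (fun a => C a i) l : Set G)) ∧
      μ.real (T i * (windowCenters P U (fun a => C a i) l : Set G))
        ≤ (eta ε i + β / 2) * μ.real U := by
    intro l hl i
    have he0 := eta_pos hε0 hε i
    have he1 := eta_le hε0 hε i
    rw [measureReal_mul_windowCenters hPd (hT i) (hCP i)]
    set s := ∑ a with P a ⊆ U * {l}, μ.real (P a) with hsdef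
    have hs1 : (eta ε i - β / 4) * s
        ≤ ∑ a with P a ⊆ U * {l}, μ.real (T i * (C a i : Set G)) := by
      rw [hsdef, Finset.mul_sum]
      exact Finset.sum_le_sum fun a _ => (hdens a i).1
    have hs2 : ∑ a with P a ⊆ U * {l}, μ.real (T i * (C a i : Set G))
        ≤ (eta ε i + β / 4) * s := by
      rw [hsdef, Finset.mul_sum]
      exact Finset.sum_le_sum fun a _ => (hdens a i).2
    have hs3 := hΛ l hl
    have hs4 := hsumU l
    rw [← hsdef] at hs3 hs4
    have hβU : 0 < β * μ.real U := by positivity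
    have hs0 : 0 ≤ s := Finset.sum_nonneg fun a _ => measureReal_nonneg
    constructor
    · refine le_trans ?_ hs1
      have e1 : eta ε i * ((1 - β / 4) * μ.real U) ≤ eta ε i * s := by gcongr
      have e2 : β / 4 * s ≤ β / 4 * μ.real U := by gcongr
      nlinarith
    · refine hs2.trans ?_
      calc (eta ε i + β / 4) * s ≤ (eta ε i + β / 4) * μ.real U := by gcongr
        _ ≤ _ := by gcongr; linarith
  have htile : ∀ l ∈ Λ, IsQuasiTiling μ ε β T U fun i => windowCenters P U (fun a => C a i) l := by
    intro l hl
    refine ⟨fun i => mul_windowCenters_subset (hCP i) l,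
      fun i => (canSplit_windowCenters (hT1 i) hPd (hCP i) (fun a => hs a i) l).epsDisjoint,
      fun i j hij => disjoint_mul_windowCenters hPd (hCP i) (hCP j)
        (fun a => (hC a).disjoint hij) l, fun i => ?_⟩
    have h := hdensU l hl i
    rw [← le_div_iff₀ hU0, ← div_le_iff₀ hU0] at h
    rw [abs_lt]
    constructor <;> linarith [h.1, h.2]
  refine ⟨hΛm, ?_, hΛtop, htile, fun l hl => (htile l hl).le_covering hε0 hε hβ hT, ?_, ?_,
    fun l _ i => canSplit_windowCenters (hT1 i) hPd (hCP i) (fun a => hs a i) l⟩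
  · exact (ENNReal.toReal_pos_iff.1 hΛ0).1
  · intro i B hB _
    exact (integrableOn_ncard_windowCenters (hT1 i) hPd hU.isClosed (hCP i) hB hΛtop).div_const _
  · intro i B hB hBU
    have hBtop : μ B < ∞ := (measure_mono hBU).trans_lt hU.measure_lt_top
    have hUB := measureReal_sdiff hBU hB hU.measure_lt_top.ne (μ := μ)
    have hUBm : MeasurableSet (U \ B) := hU.measurableSet.diff hB
    have hIB := integrableOn_ncard_windowCenters (μ := μ) (hT1 i) hPd hU.isClosed (hCP i) hB hΛtop
    have hIUB := integrableOn_ncard_windowCenters (μ := μ) (hT1 i) hPd hU.isClosed (hCP i) hUBm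
      hΛtop
    rw [integral_div]
    refine abs_density_sub_lt hε0 hε hβ0 hβ1 (eta_pos hε0 hε i) (eta_le hε0 hε i) (hTr i) hΛ0 hU0
      (n := ((∑ a, (C a i).card : ℕ) : ℝ)) (w := μ.real W)
      (y := ∫ l in Λ, (((windowCenters P U (fun a => C a i) l : Set G) ∩ (U \ B)).ncard : ℝ) ∂μ)
      ?_ hΛW measureReal_nonneg (measureReal_mono hBU hU.measure_lt_top.ne)
      (integral_ncard_windowCenters_le (hT1 i) hPd hU.isClosed (hCP i) hB hBtop hΛtop) ?_ ?_
    · push_cast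
      rw [Finset.sum_mul]
      calc ∑ a, ((C a i).card : ℝ) * ((1 - ε) * μ.real (T i))
          ≤ ∑ a, (eta ε i + β / 4) * μ.real (P a) := Finset.sum_le_sum fun a _ =>
            ((hs a i).card_mul_le (hT i)).trans (hdens a i).2
        _ = (eta ε i + β / 4) * μ.real (⋃ a, P a) := by
            rw [← Finset.mul_sum, measureReal_iUnion_fintype hPd hPm hPtop]
        _ ≤ _ := by
            have := eta_pos hε0 hε i
            gcongr
            · exact hW.measure_lt_top.ne
            · exact iUnion_subset hPW
    · rw [← hUB]
      exact integral_ncard_windowCenters_le (hT1 i) hPd hU.isClosed (hCP i) hUBm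
        ((measure_mono sdiff_subset).trans_lt hU.measure_lt_top) hΛtop
    -- In every good window the covered part has measure at least `(η_i - β/2)|U|` and at most the
    -- number of centers times `|T_i|`; all centers lie in `U`, so they are counted in `B` or in `U
    -- \ B`.
    · rw [← integral_add hIB hIUB, ← integral_mul_const]
      have hc : (eta ε i - β / 2) * μ.real U * μ.real Λ
          = ∫ _ in Λ, (eta ε i - β / 2) * μ.real U ∂μ := by
        rw [setIntegral_const, smul_eq_mul, mul_comm]
      rw [hc]
      refine setIntegral_mono_on (integrableOn_const hΛtop.ne) ((hIB.add hIUB).mul_const _) hΛm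
        fun l hl => (hdensU l hl i).1.trans ((measureReal_mul_finset_le _ _ _).trans ?_)
      gcongr
      have hsub := windowCenters_subset (U := U) (hT1 i) (hCP i) l
      have hdec : (windowCenters P U (fun a => C a i) l : Set G)
          = ((windowCenters P U (fun a => C a i) l : Set G) ∩ B)
            ∪ ((windowCenters P U (fun a => C a i) l : Set G) ∩ (U \ B)) := by
        rw [← inter_union_distrib_left, union_sdiff_cancel hBU, inter_eq_left.2 hsub]
      rw [← Set.ncard_coe_finset]
      conv_lhs => rw [hdec]
      exact_mod_cast Set.ncard_union_le _ _

end UniformFamily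

section Shift

variable {G : Type*} [Group G]

lemma IsNested.comp_add {S : ℕ → Set G} (hS : IsNested S) (n : ℕ) :
    IsNested fun k => S (k + n) :=
  ⟨monotone_nat_of_le_succ hS.2 (Nat.zero_le _) hS.1, fun k => by
    have := hS.2 (k + n)
    rwa [add_right_comm] at this⟩

lemma IsStrongFolner.comp_add [TopologicalSpace G] [MeasurableSpace G] {μ : Measure G}
    {S : ℕ → Set G} (hS : IsStrongFolner μ S) (n : ℕ) :
    IsStrongFolner μ fun k => S (k + n) :=
  ⟨fun _ => hS.nonempty _, fun _ => hS.isCompact _, fun K hK hKc =>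
    (hS.tendsto K hK hKc).comp (tendsto_add_atTop_nat n)⟩

end Shift

/-! ### Choice of the auxiliary tower, the large set and the index `K`. -/

section Existence

universe u

variable {G : Type u} [Group G] [TopologicalSpace G] [IsTopologicalGroup G] [T2Space G]
  [MeasurableSpace G] [BorelSpace G] {μ : Measure G} [μ.IsHaarMeasure] [μ.IsMulRightInvariant]

/-- A strong quasi tiling of `W` by the sets `V j` decomposes most of `W` into invariant pieces of
translates of the `V j`. -/
lemma StronglyQuasiTiles.exists_pieces {τ β ζ δ : ℝ} {L W : Set G} (hτ0 : 0 < τ) (hτ : τ ≤ 1 / 10)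
    (hβ : tileNum τ * β ≤ τ) {V : Fin (tileNum τ) → Set G} (hV : ∀ j, IsCompact (V j))
    (h : StronglyQuasiTiles μ τ β ζ δ L V) (hW : IsCompact W)
    (hWi : IsKInvariant μ (largest V * (largest V)⁻¹) δ W)
    (hWl : μ (largest V) < ENNReal.ofReal δ * μ W) :
    ∃ (ι : Type u) (_ : Fintype ι) (P : ι → Set G) (j : ι → Fin (tileNum τ)) (e : ι → G),
      (∀ a, MeasurableSet (P a)) ∧ (Pairwise fun a b => Disjoint (P a) (P b)) ∧ (∀ a, P a ⊆ W) ∧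
      (∀ a, P a ⊆ V (j a) * {e a}) ∧ (∀ a, (1 - τ) * μ.real (V (j a)) ≤ μ.real (P a)) ∧
      (∀ a, IsKInvariant μ L (4 * ζ) (P a)) ∧ (1 - 2 * τ) * μ.real W ≤ ∑ a, μ.real (P a) := by
  have hW0 : 0 < μ.real W := ENNReal.toReal_pos hWi.measure_pos.ne' hW.measure_lt_top.ne
  obtain ⟨E, hE, hs⟩ := h W hW.measurableSet (by rwa [hW.isClosed.closure_eq]) hWi hWl
  choose D hD hdisj hU using hs
  have hDE : ∀ j, ∀ e ∈ E j, D j e * {e} ⊆ V j * (E j : Set G) := fun j e he => by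
    rw [hU j]
    exact subset_biUnion_of_mem (u := fun e => D j e * {e}) he
  have hm : ∀ j, ∀ e ∈ E j, MeasurableSet (D j e * {e}) := fun j e he =>
    measurableSet_mul_singleton (hD j e he).1 e
  have htop : ∀ j, ∀ e ∈ E j, μ (D j e * {e}) ≠ ∞ := fun j e he =>
    measure_ne_top_of_subset (hDE j e he) (measure_mul_finset_lt_top (hV j) _).ne
  refine ⟨Σ j, E j, inferInstance, fun a => D a.1 a.2 * {(a.2 : G)}, fun a => a.1, fun a => a.2,
    fun a => hm _ _ a.2.2, ?_, fun a => (hDE _ _ a.2.2).trans (hE.subset _),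
    fun a => mul_subset_mul_right (hD _ _ a.2.2).2.1, fun a => ?_,
    fun a => (hD _ _ a.2.2).2.2.2.1.mul_singleton _, ?_⟩
  · rintro ⟨i, e, he⟩ ⟨j, f, hf⟩ hne
    by_cases hij : i = j
    · subst hij
      exact hdisj i he hf fun hef => hne (by simp only at hef; subst hef; rfl)
    · exact (hE.disjoint hij).mono (hDE i e he) (hDE j f hf)
  · rw [measureReal_mul_singleton]
    exact (hD _ _ a.2.2).2.2.1
  · rw [Fintype.sum_sigma]
    have hj : ∀ j, ∑ e : E j, μ.real (D j e * {(e : G)}) = μ.real (V j * (E j : Set G)) := by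
      intro j
      rw [hU j, measureReal_biUnion_finset (hdisj j) (hm j) (htop j)]
      exact Finset.sum_coe_sort (E j) fun e => μ.real (D j e * {e})
    simp_rw [hj]
    have h1 : ∑ j : Fin (tileNum τ), (eta τ j - β) * μ.real W
        ≤ ∑ j, μ.real (V j * (E j : Set G)) := by
      refine Finset.sum_le_sum fun j _ => ?_
      rw [← le_div_iff₀ hW0]
      linarith [(abs_lt.1 (hE.density j)).1]
    rw [← Finset.sum_mul, Finset.sum_sub_distrib, sum_eta] at h1
    simp only [Finset.sum_const, Finset.card_univ, Fintype.card_fin, nsmul_eq_mul] at h1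
    refine le_trans ?_ h1
    refine mul_le_mul_of_nonneg_right ?_ hW0.le
    linarith [pow_tileNum_le hτ0 hτ]

variable [LocallyCompactSpace G] [SecondCountableTopology G] [NoncompactSpace G]

/-- Far out in a strong Følner sequence there are uniform families of quasi tilings. -/
lemma exists_forall_exists_isUniformFamily {U S : ℕ → Set G} (hU : IsStrongFolner μ U)
    (hS : IsStrongFolner μ S) (hn : IsNested S) {ε β : ℝ} (hε0 : 0 < ε) (hε : ε ≤ 1 / 10)
    (hβ0 : 0 < β) (hβ : β < ε / 2 ^ tileNum ε) {T : Fin (tileNum ε) → Set G}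
    (hT : ∀ i, IsCompact (T i)) (hT1 : ∀ i, 1 ∈ T i) (hT0 : ∀ i, 0 < μ (T i)) :
    ∃ K : ℕ, ∀ k, K ≤ k → ∀ (ζ : ℝ) (L : Set G), StronglyQuasiTiles μ ε (β / 4) ζ (β / 8) L T →
      ∃ (Λ : Set G) (C : G → Fin (tileNum ε) → Finset G),
        IsUniformFamily μ ε β ζ L T (fun i => 2 * eta ε i / μ.real (T i)) (U k) Λ C := by
  have : μ.IsInvInvariant := isInvInvariant_of_unimodular μ
  have hβ1 : β ≤ 1 / 10 := by
    have : ε / 2 ^ tileNum ε ≤ ε := div_le_self hε0.le (one_le_pow₀ (by norm_num))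
    linarith
  have hlT := isCompact_largest hT
  set L' := largest T * (largest T)⁻¹ with hL'
  have hL'c : IsCompact L' := hlT.mul hlT.inv
  have hL'1 : (1 : G) ∈ L' := by
    have i : Fin (tileNum ε) := ⟨0, tileNum_pos hε0 hε⟩
    exact largest_subset_mul_inv hT1 i (subset_largest T i (hT1 i))
  set τ := β ^ 2 / 32 with hτ
  have hτ0 : 0 < τ := by positivity
  have hτ1 : τ ≤ 1 / 10 := by rw [hτ]; nlinarith
  set β₁ := τ / (tileNum τ + 1) with hβ₁
  have hβ₁0 : 0 < β₁ := by positivity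
  have hβ₁τ : tileNum τ * β₁ ≤ τ := by
    rw [hβ₁, mul_div_assoc', div_le_iff₀ (by positivity)]
    nlinarith
  -- The shift by `n₀` makes the pieces so large that `|T_N| < (β/8)|P a|`; the factor 2 absorbs the
  -- loss `1 - τ`. Below, `ζ = β/32` makes them `(T_N T_N⁻¹, β/8)`-invariant.
  obtain ⟨n₀, hn₀⟩ := eventually_atTop.1
    (hS.eventually_le_measure (2 * (μ.real (largest T) / (β / 8))))
  obtain ⟨V, hV1, -, hVS, -, hVt⟩ := exists_stronglyQuasiTiles (hS.comp_add n₀) (hn.comp_add n₀)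
    hL'c hL'1 hτ0 hτ1 hβ₁0 (ζ := β / 32) (by positivity) (by linarith) (tileNum τ)
  have hVc : ∀ j, IsCompact (V j) := fun j => by
    obtain ⟨n, -, h⟩ := hVS j
    rw [h]; exact hS.isCompact _
  have hVl : ∀ j, 2 * (μ.real (largest T) / (β / 8)) < μ.real (V j) := fun j => by
    obtain ⟨n, -, h⟩ := hVS j
    rw [h]; exact hn₀ _ (Nat.le_add_left _ _)
  have hlV := isCompact_largest hVc
  obtain ⟨K, hK⟩ := eventually_atTop.1 (hU.eventually_isKInvariant hlV hτ0)
  refine ⟨K, fun k hk ζ L hTt => ?_⟩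
  have hUi := hK k hk
  have hUc := hU.isCompact k
  have hU0 : 0 < μ.real (U k) := ENNReal.toReal_pos hUi.measure_pos.ne' hUc.measure_lt_top.ne
  -- The large set is chosen after the window: `U m` must be invariant under `U k` itself.
  obtain ⟨m, hm1, hm2, hm3⟩ := ((hU.eventually_isKInvariant (hlV.mul hlV.inv) (half_pos hβ₁0)).and
    ((hU.eventually_isKInvariant hUc hτ0).and
      (hU.eventually_le_measure (μ.real (largest V) / (β₁ / 2))))).exists
  have hWc := hU.isCompact m
  set W := U m
  have hW0 : 0 < μ.real W := ENNReal.toReal_pos hm1.measure_pos.ne' hWc.measure_lt_top.ne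
  obtain ⟨ι, _, P, j, e, hPm, hPd, hPW, hPV, hPr, hPi, hsum⟩ :=
    hVt.exists_pieces hτ0 hτ1 hβ₁τ hVc hWc hm1 (by
      rw [div_lt_iff₀ (by positivity)] at hm3
      rw [← ofReal_measureReal hlV.measure_lt_top.ne, ← ofReal_measureReal hWc.measure_lt_top.ne,
        ← ENNReal.ofReal_mul (by positivity),
        ENNReal.ofReal_lt_ofReal_iff_of_nonneg measureReal_nonneg]
      linarith)
  have hPl : ∀ a, μ.real (largest T) / (β / 8) < μ.real (P a) := fun a => by
    have h1 := hVl (j a)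
    have h2 := hPr a
    have h3 : 0 ≤ μ.real (V (j a)) := measureReal_nonneg
    nlinarith
  have hPtop : ∀ a, μ (P a) ≠ ∞ := fun a => measure_ne_top_of_subset (hPW a) hWc.measure_lt_top.ne
  have hP0 : ∀ a, 0 < μ.real (P a) := fun a => lt_of_le_of_lt (by positivity) (hPl a)
  have htile : ∀ a, ∃ C : Fin (tileNum ε) → Finset G, IsQuasiTiling μ ε (β / 4) T (P a) C ∧
      ∀ i, CanSplit μ ε ζ L (T i) (C i) := by
    intro a
    refine hTt (P a) (hPm a) (hWc.of_isClosed_subset isClosed_closure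
      (closure_minimal (hPW a) hWc.isClosed)) ((hPi a).mono le_rfl (by linarith)) ?_
    have h := hPl a
    rw [div_lt_iff₀ (by positivity)] at h
    rw [← ofReal_measureReal hlT.measure_lt_top.ne, ← ofReal_measureReal (hPtop a),
      ← ENNReal.ofReal_mul (by positivity),
      ENNReal.ofReal_lt_ofReal_iff_of_nonneg measureReal_nonneg]
    linarith
  choose C hC hCs using htile
  obtain ⟨Λ, hΛm, hΛtop, hΛW, hΛ⟩ := exists_good_windows (μ := μ) (U := U k) (W := W) (β := β)
    (τ := τ) hPm hPd hUc hU0 hWc hβ0 hτ0.le (by linarith) (by rw [hτ]; linarith) (by linarith) hsum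
    (fun a => measureReal_setOf_subset_ge hUc hWc hτ0.le (hV1 (j a)) (hPV a) (hPW a)
      (nonempty_of_measureReal_ne_zero (hP0 a).ne')
      (hUi.mono (subset_largest V (j a)) le_rfl))
    (measureReal_inv_mul_le (hU.nonempty k) hWc hτ0.le hm2)
  exact ⟨Λ, _, isUniformFamily_windowCenters hε0 hε hβ0 hβ hT hT1 hT0 hUc hU0 hWc hW0 hPm hPd hPW
    hP0 hC hCs hΛm hΛtop hΛW hΛ⟩

theorem uniformContinuousDecompositions : UniformContinuousDecompositions μ := by
  refine ⟨fun β => β / 8, fun β hβ => by positivity, fun U hU ε hε0 hε β hβ0 hβ => ?_⟩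
  -- `K` has to be fixed before `ζ`, `S` and `L`. The auxiliary tower can come from any nested
  -- strong Følner sequence, so `K` is chosen for each `T` separately, with value 0 for unsuitable
  -- `T`.
  have hK : ∀ T : Fin (tileNum ε) → Set G, ∃ K : ℕ,
      (∃ S : ℕ → Set G, IsStrongFolner μ S ∧ IsNested S) → (∀ i, IsCompact (T i)) →
      (∀ i, 1 ∈ T i) → (∀ i, 0 < μ (T i)) →
      ∀ k, K ≤ k → ∀ (ζ : ℝ) (L : Set G), StronglyQuasiTiles μ ε (β / 4) ζ (β / 8) L T →
        ∃ (Λ : Set G) (C : G → Fin (tileNum ε) → Finset G),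
          IsUniformFamily μ ε β ζ L T (fun i => 2 * eta ε i / μ.real (T i)) (U k) Λ C := by
    intro T
    by_cases h : (∃ S : ℕ → Set G, IsStrongFolner μ S ∧ IsNested S) ∧ (∀ i, IsCompact (T i)) ∧
      (∀ i, 1 ∈ T i) ∧ (∀ i, 0 < μ (T i))
    · obtain ⟨⟨S, hS, hn⟩, hT, hT1, hT0⟩ := h
      obtain ⟨K, hK⟩ := exists_forall_exists_isUniformFamily hU hS hn hε0 hε hβ0 hβ hT hT1 hT0
      exact ⟨K, fun _ _ _ _ => hK⟩
    · exact ⟨0, fun h1 h2 h3 h4 => absurd ⟨h1, h2, h3, h4⟩ h⟩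
  choose K hK using hK
  refine ⟨K, fun ζ hζ0 hζ S hS hn L hL hL1 => ?_⟩
  have hζ1 : ζ ≤ 1 := by
    have : ε / 2 ^ tileNum ε ≤ ε := div_le_self hε0.le (one_le_pow₀ (by norm_num))
    linarith
  obtain ⟨T, hT1, hTm, hTS, hTi, hTt⟩ := exists_stronglyQuasiTiles hS hn hL hL1 hε0 hε
    (β := β / 4) (by positivity) hζ0 hζ1 (tileNum ε)
  rw [show β / 4 / 2 = β / 8 by ring] at hTt
  have hTc : ∀ i, IsCompact (T i) := fun i => by
    obtain ⟨n, -, h⟩ := hTS i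
    rw [h]; exact hS.isCompact _
  have hT0 : ∀ i, 0 < μ (T i) := fun i => (hTi i).measure_pos
  have hTr : ∀ i, 0 < μ.real (T i) := fun i =>
    ENNReal.toReal_pos (hT0 i).ne' (hTc i).measure_lt_top.ne
  refine ⟨T, ⟨hT1, hTm, hTS, hTi, hTt.quasiTilesGroup (by linarith)⟩,
    fun i => 2 * eta ε i / μ.real (T i),
    fun i => div_pos (mul_pos two_pos (eta_pos hε0 hε i)) (hTr i), ?_,
    fun k hk => hK T ⟨S, hS, hn⟩ hTc hT1 hT0 k hk ζ L hTt⟩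
  have h1 : ∀ i, 2 * eta ε i / μ.real (T i) * μ.real (T i) = 2 * eta ε i := fun i =>
    div_mul_cancel₀ _ (hTr i).ne'
  simp_rw [h1]
  rw [← Finset.mul_sum, sum_eta]
  have : 0 ≤ (1 - ε) ^ tileNum ε := pow_nonneg (by linarith) _
  linarith

end Existence

end QuasiTiling

theorem theorem3p4 {G : Type*} [Group G] [TopologicalSpace G] [IsTopologicalGroup G] [T2Space G]
    [LocallyCompactSpace G] [SecondCountableTopology G] [NoncompactSpace G]
    [MeasurableSpace G] [BorelSpace G]
    (μ : Measure G) [μ.IsHaarMeasure] [μ.IsMulRightInvariant]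
    (hG : QuasiTiling.IsAmenable G) :
    QuasiTiling.UniformContinuousDecompositions μ :=
  QuasiTiling.uniformContinuousDecompositions
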